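/- **Setting.** A Hilbert complex $(W,\mathrm d)$ consists of real Hilbert spaces $W^k$ ($k\in\mathbb Z$) and closed, densely defined linear maps $\mathrm d^k\colon V^k\subset W^k\to V^{k+1}\subset W^{k+1}$ with $\mathrm d^{k}\mathrm d^{k-1}=0$; it is closed if every $\mathrm d^kV^k$ is closed in $W^{k+1}$. Its domain complex is $(V,\mathrm d)$ with $\langle u,v\rangle_V=\langle u,v\rangle+\langle \mathrm du,\mathrm dv\rangle$. Put $\mathfrak Z^k=\ker \mathrm d^k$, $\mathfrak B^k=\mathrm d^{k-1}V^{k-1}$, $\mathfrak H^k=\mathfrak Z^k\cap\mathfrak B^{k\perp}$, let $P_{\mathfrak B}$ be the $W$-orthogonal projection onto $\mathfrak B^k$, and let the Poincaré constant in degree $j$ be the least $c\ge 0$ with $\|v\|_V\le c\|\mathrm dv\|$ for all $v\in\mathfrak Z^{j\perp}\subset V^j$. Let $(W,\mathrm d)$ be a closed Hilbert complex, and let $(W_h,\mathrm d_h)$ be a Hilbert complex with domain complex $V_h$, inner product $\langle\cdot,\cdot\rangle_h$ and harmonic spaces $\mathfrak H_h^k$ (not necessarily a subcomplex of $V$). Let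 $i_h\colon W_h\to W$ be a morphism of Hilbert complexes (bounded maps $W_h^k\to W^k$ that map $V_h^k$ into $V^k$ and commute with the differentials) and let $\pi_h\colon V\to V_h$ be a $V$-bounded cochain map with $\pi_h^k\circ i_h^k=\mathrm{id}_{V_h^k}$. Let $i_h^*\colon W^k\to W_h^k$ be the adjoint of $i_h$, let $J_h=i_h^*i_h$, and let $P_{V_h}\colon V^k\to V_h^k$ be the map for which $i_hP_{V_h}v$ is the $V$-orthogonal projection of $v$ onto $i_hV_h^k$. Fix a degree $k$, write $\|I-J_h\|$ for the maximum of the operator norms of $I-J_h$ on $W_h^{k-1},W_h^k,W_h^{k+1}$, and put $\mu=\sup\{\|(I-i_h\pi_h)r\| : r\in\mathfrak H^k,\ \|r\|=1\}$ ($\mu=0$ if $\mathfrak H^k=0$). For $F\colon V^k\to W^k$ and $f\in W^k$, a solution of the continuous mixed semilinear problem is a triple $(\sigma,u,p)\in V^{k-1}\times V^k\times\mathfrak H^k$ with $$\langle\sigma,\tau\rangle-\langle u,\mathrm d\tau\rangle=0\quad\forall\tau\in V^{k-1},$$ $$\langle \mathrm d\sigma,v\rangle+\langle \mathrm du,\mathrm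 dv\rangle+\langle p,v\rangle+\langle F(u+p),v\rangle=\langle f,v\rangle\quad\forall v\in V^k,$$ $$\langle u,q\rangle=0\quad\forall q\in\mathfrak H^k.$$ For $F_h\colon V_h^k\to W_h^k$ and $f_h\in W_h^k$, a solution $(\sigma_h,u_h,p_h)\in V_h^{k-1}\times V_h^k\times\mathfrak H_h^k$ of the discrete problem is defined by the same equations in $(W_h,\mathrm d_h)$, with $F_h,f_h$ in place of $F,f$. **Theorem.** For all real numbers $c_P,M_i,M_\pi,\Lambda$ there is a constant $C>0$, depending only on these four numbers (in particular not on $h$), such that the following holds in the above setting. Suppose that the Poincaré constants of $(W,\mathrm d)$ in degrees $k-1$ and $k$ are at most $c_P$, and that in the degrees $k-1,k,k+1$ one has $\|i_h\|\le M_i$ in the $W$-norms and $\|\pi_h\|\le M_\pi$ in the $V$-norms. Suppose that $F_h$ is Lipschitz with constant $\Lambda$, $\|F_hx-F_hy\|_h\le\Lambda\|x-y\|_{V_h}$, and monotone, $\langle F_hx-F_hy,x-y\rangle_h\ge 0$, for all $x,y\in V_h^k$. Let $F\colon V^k\to W^k$ be any operator, $f\in W^k$, $f_h\in W_h^k$,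 and let $(\sigma,u,p)$ and $(\sigma_h,u_h,p_h)$ be solutions of the continuous and of the discrete problem. Then $$\begin{aligned} &\|\sigma-i_h\sigma_h\|_V+\|u-i_hu_h\|_V+\|p-i_hp_h\|\\ &\quad\le C\Bigl(\inf_{\tau\in i_hV_h^{k-1}}\|\sigma-\tau\|_V+\inf_{v\in i_hV_h^k}\|u-v\|_V+\inf_{q\in i_hV_h^k}\|p-q\|_V+\mu\inf_{v\in i_hV_h^k}\|P_{\mathfrak B}u-v\|_V\\ &\qquad\quad+\bigl\|i_h^*\bigl(f-F(u+p)\bigr)-\bigl(f_h-F_hP_{V_h}(u+p)\bigr)\bigr\|_h+\|I-J_h\|\,\|f-F(u+p)\|\Bigr). \end{aligned}$$ -/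

import Mathlib

universe u v

/-- A (real) Hilbert complex: Hilbert spaces `W k`, `k ∈ ℤ`, and closed, densely defined linear maps
`d k : V k ⊆ W k → V (k + 1) ⊆ W (k + 1)` with `d (k + 1) ∘ d k = 0`. -/
structure HilbertComplex where
  W : ℤ → Type u
  [normed : ∀ k, NormedAddCommGroup (W k)]
  [innerProd : ∀ k, InnerProductSpace ℝ (W k)]
  [complete : ∀ k, CompleteSpace (W k)]
  d : ∀ k, W k →ₗ.[ℝ] W (k + 1)
  d_closed : ∀ k, (d k).IsClosed
  d_dense : ∀ k, Dense ((d k).domain : Set (W k))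
  d_mem : ∀ k (x : (d k).domain), d k x ∈ (d (k + 1)).domain
  d_comp_d : ∀ k (x : (d k).domain), d (k + 1) ⟨d k x, d_mem k x⟩ = 0

namespace HilbertComplex

attribute [instance] HilbertComplex.normed HilbertComplex.innerProd HilbertComplex.complete

/-- The spaces of the domain complex: the domain of `d k`, with the graph inner product below. -/
def V (C : HilbertComplex.{u}) (k : ℤ) : Type u := (C.d k).domain

variable (C : HilbertComplex.{u}) (k : ℤ)

instance : AddCommGroup (C.V k) := inferInstanceAs (AddCommGroup (C.d k).domain)

instance : Module ℝ (C.V k) := inferInstanceAs (Module ℝ (C.d k).domain)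

/-- The inclusion `V k → W k`, as a linear map. -/
def toWₗ : C.V k →ₗ[ℝ] C.W k := (C.d k).domain.subtype

/-- The differential `V k → W (k + 1)`, as a linear map. -/
def dWₗ : C.V k →ₗ[ℝ] C.W (k + 1) := (C.d k).toFun

theorem toWₗ_injective : Function.Injective (C.toWₗ k) := Subtype.val_injective

/-- The graph inner product `⟨u, v⟩_V = ⟨u, v⟩ + ⟨d u, d v⟩`. -/
@[reducible] def graphCore : InnerProductSpace.Core ℝ (C.V k) where
  inner u v := inner ℝ (C.toWₗ k u) (C.toWₗ k v) + inner ℝ (C.dWₗ k u) (C.dWₗ k v)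
  conj_inner_symm u v := by simp [real_inner_comm]
  re_inner_nonneg u := by
    simp only [RCLike.re_to_real]
    exact add_nonneg real_inner_self_nonneg real_inner_self_nonneg
  add_left u v w := by simp only [map_add, inner_add_left]; ring
  smul_left u v r := by simp only [map_smul, inner_smul_left]; ring
  definite u h := by
    have h1 : (0 : ℝ) ≤ inner ℝ (C.toWₗ k u) (C.toWₗ k u) := real_inner_self_nonneg
    have h2 : (0 : ℝ) ≤ inner ℝ (C.dWₗ k u) (C.dWₗ k u) := real_inner_self_nonneg
    have h3 : inner ℝ (C.toWₗ k u) (C.toWₗ k u) = (0 : ℝ) := by linarith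
    apply C.toWₗ_injective k
    rw [map_zero]
    exact inner_self_eq_zero.mp h3

/-- The `V`-norm. -/
noncomputable instance : NormedAddCommGroup (C.V k) := (C.graphCore k).toNormedAddCommGroup

noncomputable instance : InnerProductSpace ℝ (C.V k) :=
  InnerProductSpace.ofCore (C.graphCore k).toCore

theorem inner_V (u v : C.V k) : inner ℝ u v =
    inner ℝ (C.toWₗ k u) (C.toWₗ k v) + inner ℝ (C.dWₗ k u) (C.dWₗ k v) := rfl

theorem norm_V_sq (u : C.V k) : ‖u‖ ^ 2 = ‖C.toWₗ k u‖ ^ 2 + ‖C.dWₗ k u‖ ^ 2 := by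
  rw [← real_inner_self_eq_norm_sq, inner_V, real_inner_self_eq_norm_sq,
    real_inner_self_eq_norm_sq]

theorem norm_toWₗ_le (u : C.V k) : ‖C.toWₗ k u‖ ≤ ‖u‖ :=
  abs_le_of_sq_le_sq' (by rw [norm_V_sq]; nlinarith [sq_nonneg ‖C.dWₗ k u‖]) (norm_nonneg _) |>.2

theorem norm_dWₗ_le (u : C.V k) : ‖C.dWₗ k u‖ ≤ ‖u‖ :=
  abs_le_of_sq_le_sq' (by rw [norm_V_sq]; nlinarith [sq_nonneg ‖C.toWₗ k u‖]) (norm_nonneg _) |>.2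

theorem norm_V_le (u : C.V k) : ‖u‖ ≤ ‖C.toWₗ k u‖ + ‖C.dWₗ k u‖ :=
  abs_le_of_sq_le_sq' (by
    rw [norm_V_sq]
    nlinarith [mul_nonneg (norm_nonneg (C.toWₗ k u)) (norm_nonneg (C.dWₗ k u))])
    (by positivity) |>.2

/-- The bounded inclusion `V k → W k`. -/
noncomputable def toW : C.V k →L[ℝ] C.W k :=
  (C.toWₗ k).mkContinuous 1 fun u => by simpa using C.norm_toWₗ_le k u

/-- The differential as a bounded map `V k → W (k + 1)`. -/
noncomputable def dW : C.V k →L[ℝ] C.W (k + 1) :=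
  (C.dWₗ k).mkContinuous 1 fun u => by simpa using C.norm_dWₗ_le k u

/-- The differential of the domain complex as a linear map `V k → V (k + 1)`. -/
def dVₗ : C.V k →ₗ[ℝ] C.V (k + 1) := (C.dWₗ k).codRestrict (C.d (k + 1)).domain (C.d_mem k)

theorem toWₗ_dVₗ (u : C.V k) : C.toWₗ (k + 1) (C.dVₗ k u) = C.dWₗ k u := rfl

theorem dWₗ_dVₗ (u : C.V k) : C.dWₗ (k + 1) (C.dVₗ k u) = 0 := C.d_comp_d k u

/-- The differential of the domain complex, a bounded map `V k → V (k + 1)`. -/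
noncomputable def dV : C.V k →L[ℝ] C.V (k + 1) :=
  (C.dVₗ k).mkContinuous 1 fun u => by
    have h := C.norm_V_le (k + 1) (C.dVₗ k u)
    rw [toWₗ_dVₗ, dWₗ_dVₗ, norm_zero, add_zero] at h
    linarith [C.norm_dWₗ_le k u]

/-- The domain complex consists of Hilbert spaces. -/
instance : CompleteSpace (C.V k) := by
  let e : C.V k →L[ℝ] C.W k × C.W (k + 1) := (C.toW k).prod (C.dW k)
  have he : AntilipschitzWith 2 e := by
    refine AddMonoidHomClass.antilipschitz_of_bound e fun u => ?_
    have h1 : ‖C.toWₗ k u‖ ≤ ‖e u‖ := le_max_left _ _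
    have h2 : ‖C.dWₗ k u‖ ≤ ‖e u‖ := le_max_right _ _
    have h3 := C.norm_V_le k u
    push_cast
    linarith
  rw [completeSpace_iff_isComplete_range (he.isUniformInducing e.uniformContinuous)]
  have hr : Set.range e = ((C.d k).graph : Set (C.W k × C.W (k + 1))) := by
    ext ⟨x, y⟩
    simp only [Set.mem_range, SetLike.mem_coe, LinearPMap.mem_graph_iff]
    constructor
    · rintro ⟨u, hu⟩
      exact ⟨u, congrArg Prod.fst hu, congrArg Prod.snd hu⟩
    · rintro ⟨u, h1, h2⟩
      exact ⟨u, Prod.ext h1 h2⟩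
  rw [hr]
  exact (C.d_closed k).isComplete

/-- A Hilbert complex is closed if every differential has closed image. -/
def IsClosedComplex : Prop := ∀ k, IsClosed (Set.range (C.d k) : Set (C.W (k + 1)))

/-- The `k`-cocycles `𝔷^k = ker d^k`. -/
noncomputable def cocycles : Submodule ℝ (C.V k) := LinearMap.ker (C.dV k : C.V k →ₗ[ℝ] C.V (k + 1))

/-- The `(k + 1)`-coboundaries `𝔅^{k+1} = d^k V^k`, as a subspace of `W^{k+1}`. -/
def coboundaries : Submodule ℝ (C.W (k + 1)) := LinearMap.range (C.dWₗ k)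

/-- The harmonic space `ℌ^{k+1} = 𝔷^{k+1} ∩ (𝔅^{k+1})^⊥` in degree `k + 1`; orthogonality is with
respect to the inner product of `W^{k+1}`. -/
noncomputable def harmonic : Submodule ℝ (C.V (k + 1)) :=
  C.cocycles (k + 1) ⊓ ((C.coboundaries k)ᗮ).comap (C.toWₗ (k + 1))

/-- The Poincaré constant in degree `k`: the least `c ≥ 0` such that `‖v‖_V ≤ c ‖d v‖` for all
`v` in `𝔷^{k⊥}` (in a closed complex there is such a `c`). -/
noncomputable def poincareConst : ℝ :=
  sInf {c : ℝ | 0 ≤ c ∧ ∀ v ∈ (C.cocycles k)ᗮ, ‖v‖ ≤ c * ‖C.dW k v‖}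

theorem projB_mem (u : C.W (k + 1)) :
    (C.coboundaries k).topologicalClosure.starProjection u ∈ (C.d (k + 1)).domain := by
  have hmem : (C.coboundaries k).topologicalClosure.starProjection u ∈
      closure ((C.coboundaries k : Submodule ℝ (C.W (k + 1))) : Set (C.W (k + 1))) :=
    Submodule.starProjection_apply_mem (C.coboundaries k).topologicalClosure u
  have hcl : IsClosed {x : C.W (k + 1) | (x, (0 : C.W (k + 1 + 1))) ∈ (C.d (k + 1)).graph} :=
    (C.d_closed (k + 1)).preimage (Continuous.prodMk_left (0 : C.W (k + 1 + 1)))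
  have hsub : ((C.coboundaries k : Submodule ℝ (C.W (k + 1))) : Set (C.W (k + 1))) ⊆
      {x : C.W (k + 1) | (x, (0 : C.W (k + 1 + 1))) ∈ (C.d (k + 1)).graph} := by
    rintro _ ⟨v, rfl⟩
    exact (LinearPMap.mem_graph_iff _).2 ⟨⟨C.dWₗ k v, C.d_mem k v⟩, rfl, C.d_comp_d k v⟩
  have h := closure_minimal hsub hcl hmem
  obtain ⟨y, hy, -⟩ := (LinearPMap.mem_graph_iff _).1 h
  have hy' : (y : C.W (k + 1)) = (C.coboundaries k).topologicalClosure.starProjection u := hy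
  rw [← hy']
  exact y.2

/-- `P_𝔅 u`, the `W`-orthogonal projection of `u` onto (the closure of) `𝔅^{k+1}`. It lies in
`V^{k+1}`, since it is a cocycle. In a closed complex `𝔅^{k+1}` is its own closure. -/
noncomputable def projB (u : C.V (k + 1)) : C.V (k + 1) :=
  (⟨(C.coboundaries k).topologicalClosure.starProjection (C.toW (k + 1) u),
    C.projB_mem k _⟩ : (C.d (k + 1)).domain)

/-- `(σ, u, p) ∈ V^k × V^{k+1} × ℌ^{k+1}` solves the mixed semilinear problem with nonlinear
operator `F : V^{k+1} → W^{k+1}` and functional `f ∈ W^{k+1}`. -/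
structure IsMixedSolution (F : C.V (k + 1) → C.W (k + 1)) (f : C.W (k + 1))
    (σ : C.V k) (u p : C.V (k + 1)) : Prop where
  harmonic_mem : p ∈ C.harmonic k
  eq_fst : ∀ τ : C.V k,
    inner ℝ (C.toW k σ) (C.toW k τ) - inner ℝ (C.toW (k + 1) u) (C.dW k τ) = 0
  eq_snd : ∀ v : C.V (k + 1),
    inner ℝ (C.dW k σ) (C.toW (k + 1) v) + inner ℝ (C.dW (k + 1) u) (C.dW (k + 1) v)
      + inner ℝ (C.toW (k + 1) p) (C.toW (k + 1) v)
      + inner ℝ (F (u + p)) (C.toW (k + 1) v) = inner ℝ f (C.toW (k + 1) v)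
  eq_trd : ∀ q ∈ C.harmonic k, inner ℝ (C.toW (k + 1) u) (C.toW (k + 1) q) = 0

end HilbertComplex

/-- A morphism of Hilbert complexes: bounded linear maps `W k → W' k` that send `V k` into `V' k`
and commute with the differentials. -/
structure HilbertComplex.Hom (C : HilbertComplex.{u}) (D : HilbertComplex.{v}) where
  toFun : ∀ k, C.W k →L[ℝ] D.W k
  map_mem : ∀ k (x : (C.d k).domain), toFun k x ∈ (D.d k).domain
  comm : ∀ k (x : (C.d k).domain), D.d k ⟨toFun k x, map_mem k x⟩ = toFun (k + 1) (C.d k x)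

namespace HilbertComplex.Hom

variable {C : HilbertComplex.{u}} {D : HilbertComplex.{v}} (g : C.Hom D) (k : ℤ)

/-- The restriction of a morphism to the domain complexes, as a linear map. -/
def onVₗ : C.V k →ₗ[ℝ] D.V k :=
  ((g.toFun k : C.W k →ₗ[ℝ] D.W k) ∘ₗ C.toWₗ k).codRestrict (D.d k).domain (g.map_mem k)

theorem toWₗ_onVₗ (u : C.V k) : D.toWₗ k (g.onVₗ k u) = g.toFun k (C.toWₗ k u) := rfl

theorem dWₗ_onVₗ (u : C.V k) : D.dWₗ k (g.onVₗ k u) = g.toFun (k + 1) (C.dWₗ k u) := g.comm k u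

/-- The restriction of a morphism to the domain complexes, bounded in the `V`-norms. -/
noncomputable def onV : C.V k →L[ℝ] D.V k :=
  (g.onVₗ k).mkContinuous (‖g.toFun k‖ + ‖g.toFun (k + 1)‖) fun u => by
    have h := D.norm_V_le k (g.onVₗ k u)
    rw [toWₗ_onVₗ, dWₗ_onVₗ] at h
    have h1 := (g.toFun k).le_opNorm_of_le (C.norm_toWₗ_le k u)
    have h2 := (g.toFun (k + 1)).le_opNorm_of_le (C.norm_dWₗ_le k u)
    linarith

end HilbertComplex.Hom

/-- A (not necessarily subcomplex) discretization of the Hilbert complex `C` by the Hilbert complex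
`D = (W_h, d_h)`: a `W`-bounded inclusion morphism `i_h` and a `V`-bounded projection morphism
`π_h : V → V_h` between the domain complexes with `π_h ∘ i_h = id` on `V_h`. -/
structure HilbertComplex.Discretization (C : HilbertComplex.{u}) (D : HilbertComplex.{v}) where
  i : D.Hom C
  π : ∀ k, C.V k →L[ℝ] D.V k
  π_comm : ∀ k (v : C.V k), π (k + 1) (C.dV k v) = D.dV k (π k v)
  π_i : ∀ k (v : D.V k), π k (i.onV k v) = v

namespace HilbertComplex.Discretization

variable {C : HilbertComplex.{u}} {D : HilbertComplex.{v}} (A : C.Discretization D) (k : ℤ)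

/-- The subspace `i_h V_h^k` of `V^k`. -/
noncomputable def image : Submodule ℝ (C.V k) :=
  LinearMap.range (A.i.onV k : D.V k →ₗ[ℝ] C.V k)

instance : CompleteSpace (A.image k) := by
  have hal : AntilipschitzWith ‖A.π k‖₊ (A.i.onV k) := by
    refine AddMonoidHomClass.antilipschitz_of_bound _ fun v => ?_
    have h := (A.π k).le_opNorm (A.i.onV k v)
    rwa [A.π_i] at h
  have h : IsComplete (Set.range (A.i.onV k)) :=
    hal.isComplete_range (A.i.onV k).uniformContinuous
  exact h.completeSpace_coe

/-- `P_{V_h} : V → V_h`, the map such that `i_h P_{V_h} v` is the `V`-orthogonal projection of `v`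
onto `i_h V_h`. -/
noncomputable def projVh : C.V k →L[ℝ] D.V k := (A.π k).comp (A.image k).starProjection

theorem i_projVh (v : C.V k) : A.i.onV k (A.projVh k v) = (A.image k).starProjection v := by
  obtain ⟨w, hw⟩ : ∃ w, A.i.onV k w = (A.image k).starProjection v :=
    Submodule.starProjection_apply_mem (A.image k) v
  simp only [projVh, ContinuousLinearMap.comp_apply]
  rw [← hw, A.π_i]

/-- The adjoint `i_h^* : W^k → W_h^k`. -/
noncomputable def iAdj : C.W k →L[ℝ] D.W k := ContinuousLinearMap.adjoint (A.i.toFun k)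

/-- `J_h = i_h^* i_h` on `W_h^k`. -/
noncomputable def J : D.W k →L[ℝ] D.W k := (A.iAdj k).comp (A.i.toFun k)

/-- The norm `‖I - J_h‖`, taken over the degrees `k`, `k + 1`, `k + 2` of the complex that enter
the mixed problem in degree `k + 1`. -/
noncomputable def crime : ℝ :=
  max ‖ContinuousLinearMap.id ℝ (D.W k) - A.J k‖
    (max ‖ContinuousLinearMap.id ℝ (D.W (k + 1)) - A.J (k + 1)‖
      ‖ContinuousLinearMap.id ℝ (D.W (k + 1 + 1)) - A.J (k + 1 + 1)‖)

/-- `μ = sup {‖(I - i_h π_h) r‖ : r ∈ ℌ^{k+1}, ‖r‖ = 1}` (and `μ = 0` if `ℌ^{k+1} = 0`). -/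
noncomputable def mu : ℝ :=
  ⨆ r : {r : C.V (k + 1) // r ∈ C.harmonic k ∧ ‖C.toW (k + 1) r‖ = 1},
    ‖C.toW (k + 1) (r.1 - A.i.onV (k + 1) (A.π (k + 1) r.1))‖

end HilbertComplex.Discretization

/-! ### Cocycles and Poincaré bounds. -/

namespace HilbertComplex

variable (C : HilbertComplex.{u}) {k : ℤ}

/-! The error estimate is stability plus consistency. Stability (`mixed_stability`): a triple whose
residuals in the two mixed equations are at most `ε` has size at most a constant times `ε`, even
with a monotone Lipschitz term. Monotonicity gives this term the right sign in the energy identity,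
and the Lipschitz bound is needed only to control `d s`. The constant depends on Poincaré bounds,
which pass to the discrete complex through the bounded cochain projection
(`poincareBound_of_bounds`).

Stability is applied to the discrete solution minus a comparison triple built from `π σ, π u, π p`.
Since `π u` need not be orthogonal to the discrete harmonic space and `π p` need not be harmonic,
the discrete harmonic part of `π u` and the discrete coboundary part of `π p` are removed. The
residuals consist of these corrections, the data and nonlinearity defect, and the cost of replacing
one inner product by the other, governed by `I - J`. The latter multiplies norms of the exact
solution, which continuous stability bounds by `f - F (u + p)`.

The product with `mu` arises in the correction of `π u`. A discrete harmonic form tests `u` only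
through its coboundary component, which is small by the gap estimate (`norm_sub_harmPart_le`), while
the coboundary part of `u` can be replaced by its approximation error. -/

theorem inner_eq_toW_add_dW (u v : C.V k) : inner ℝ u v =
    inner ℝ (C.toW k u) (C.toW k v) + inner ℝ (C.dW k u) (C.dW k v) := rfl

theorem norm_toW_le (u : C.V k) : ‖C.toW k u‖ ≤ ‖u‖ := C.norm_toWₗ_le k u

theorem norm_dW_le (u : C.V k) : ‖C.dW k u‖ ≤ ‖u‖ := C.norm_dWₗ_le k u

theorem norm_le_toW_add_dW (u : C.V k) : ‖u‖ ≤ ‖C.toW k u‖ + ‖C.dW k u‖ := C.norm_V_le k u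

theorem toW_dV (u : C.V k) : C.toW (k + 1) (C.dV k u) = C.dW k u := rfl

theorem dW_dV (u : C.V k) : C.dW (k + 1) (C.dV k u) = 0 := C.dWₗ_dVₗ k u

theorem toW_injective : Function.Injective (C.toW k) := C.toWₗ_injective k

variable {C}

theorem mem_cocycles_iff {z : C.V k} : z ∈ C.cocycles k ↔ C.dW k z = 0 := by
  have h : z ∈ C.cocycles k ↔ C.dV k z = 0 := Iff.rfl
  rw [h, ← toW_dV]
  exact ⟨fun h => by rw [h, map_zero], fun h => C.toW_injective (by rw [h, map_zero])⟩

theorem inner_cocycle_right {u z : C.V k} (hz : z ∈ C.cocycles k) :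
    inner ℝ u z = inner ℝ (C.toW k u) (C.toW k z) := by
  rw [inner_eq_toW_add_dW, mem_cocycles_iff.1 hz, inner_zero_right, add_zero]

theorem norm_cocycle {z : C.V k} (hz : z ∈ C.cocycles k) : ‖z‖ = ‖C.toW k z‖ :=
  le_antisymm (by simpa [mem_cocycles_iff.1 hz] using C.norm_le_toW_add_dW z) (C.norm_toW_le z)

instance : CompleteSpace (C.cocycles k) := by
  have h : IsClosed ((C.cocycles k : Submodule ℝ (C.V k)) : Set (C.V k)) := (C.dV k).isClosed_ker
  exact h.isComplete.completeSpace_coe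

theorem dV_mem_cocycles (u : C.V k) : C.dV k u ∈ C.cocycles (k + 1) :=
  mem_cocycles_iff.2 (C.dW_dV u)

theorem dW_sub_cocycle (u : C.V k) {z : C.V k} (hz : z ∈ C.cocycles k) :
    C.dW k (u - z) = C.dW k u := by
  rw [map_sub, mem_cocycles_iff.1 hz, sub_zero]

theorem dW_mem_coboundaries (u : C.V k) : C.dW k u ∈ C.coboundaries k := ⟨u, rfl⟩

/-- The bound `‖v‖_V ≤ c ‖d v‖` on the orthogonal complement of the cocycles. -/
def PoincareBound (C : HilbertComplex.{u}) (k : ℤ) (c : ℝ) : Prop :=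
  ∀ v ∈ (C.cocycles k)ᗮ, ‖v‖ ≤ c * ‖C.dW k v‖

theorem PoincareBound.mono {c c' : ℝ} (h : C.PoincareBound k c) (hc : c ≤ c') :
    C.PoincareBound k c' := fun v hv =>
  (h v hv).trans (mul_le_mul_of_nonneg_right hc (norm_nonneg _))

/-- Every `u` has the same differential as some `w` with `‖w‖_V ≤ c ‖d u‖`. -/
theorem PoincareBound.norm_sub_starProjection_le {c : ℝ} (h : C.PoincareBound k c) (u : C.V k) :
    ‖u - (C.cocycles k).starProjection u‖ ≤ c * ‖C.dW k u‖ := by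
  have h1 := h _ ((C.cocycles k).sub_starProjection_mem_orthogonal u)
  rwa [dW_sub_cocycle u ((C.cocycles k).starProjection_apply_mem u)] at h1

/-- In a closed complex the Poincaré constant is attained. -/
theorem IsClosedComplex.poincareBound (hC : C.IsClosedComplex) (k : ℤ) :
    C.PoincareBound k (C.poincareConst k) := by
  let g : (C.cocycles k)ᗮ →L[ℝ] C.W (k + 1) := (C.dW k).comp ((C.cocycles k)ᗮ).subtypeL
  have hinj : Function.Injective g := by
    refine (injective_iff_map_eq_zero g).2 fun v hv => ?_
    have h1 : (v : C.V k) ∈ C.cocycles k := mem_cocycles_iff.2 hv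
    have h2 : inner ℝ (v : C.V k) (v : C.V k) = 0 :=
      (Submodule.mem_orthogonal _ _).1 v.2 _ h1
    exact Subtype.ext (inner_self_eq_zero.1 h2)
  have hrange : Set.range g = Set.range (C.d k) := by
    ext y
    constructor
    · rintro ⟨v, rfl⟩
      exact ⟨v.1, rfl⟩
    · rintro ⟨x, rfl⟩
      refine ⟨⟨_, (C.cocycles k).sub_starProjection_mem_orthogonal x⟩, ?_⟩
      exact dW_sub_cocycle (C := C) (k := k) x ((C.cocycles k).starProjection_apply_mem x)
  -- Closed range makes the injective differential bounded below. This shows the set of admissible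
  -- constants is nonempty, so that its infimum is not the default value `0` of `sInf ∅`.
  obtain ⟨K, hK⟩ := g.antilipschitz_of_injective_of_isClosed_range hinj (hrange ▸ hC k)
  have hne : {c : ℝ | 0 ≤ c ∧ ∀ v ∈ (C.cocycles k)ᗮ, ‖v‖ ≤ c * ‖C.dW k v‖}.Nonempty := by
    refine ⟨K, K.2, fun v hv => ?_⟩
    exact ZeroHomClass.bound_of_antilipschitz g hK ⟨v, hv⟩
  have hcl : IsClosed {c : ℝ | 0 ≤ c ∧ ∀ v ∈ (C.cocycles k)ᗮ, ‖v‖ ≤ c * ‖C.dW k v‖} := by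
    simp only [Set.ofPred_and, Set.ofPred_forall]
    refine isClosed_Ici.inter (isClosed_iInter fun v => isClosed_iInter fun _ => ?_)
    exact isClosed_le continuous_const (by fun_prop)
  exact (hcl.csInf_mem hne ⟨0, fun c hc => hc.1⟩).2

/-- Turns an estimate obtained by testing with the element itself into a norm bound. -/
theorem le_of_sq_le_mul_self {s a : ℝ} (hs : 0 ≤ s) (ha : 0 ≤ a) (h : s ^ 2 ≤ a * s) : s ≤ a := by
  rcases hs.eq_or_lt with h0 | h0
  · linarith
  · exact le_of_mul_le_mul_right (by linarith [sq s]) h0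

/-! ### Hodge decomposition, with closures of the coboundaries. -/

section Projections

variable (C k)

theorem toW_projB (u : C.V (k + 1)) : C.toW (k + 1) (C.projB k u) =
    (C.coboundaries k).topologicalClosure.starProjection (C.toW (k + 1) u) := rfl

theorem toW_projB_mem (u : C.V (k + 1)) :
    C.toW (k + 1) (C.projB k u) ∈ (C.coboundaries k).topologicalClosure :=
  Submodule.starProjection_apply_mem _ _

variable {C k}

theorem norm_toW_projB_le (u : C.V (k + 1)) :
    ‖C.toW (k + 1) (C.projB k u)‖ ≤ ‖C.toW (k + 1) u‖ :=
  Submodule.norm_starProjection_apply_le _ _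

/-- The kernel of a closed operator is closed in `W`, and it contains the coboundaries because `d ∘
d = 0`. -/
theorem mem_cocycles_of_toW_mem_closure {b : C.V (k + 1)}
    (hb : C.toW (k + 1) b ∈ (C.coboundaries k).topologicalClosure) : b ∈ C.cocycles (k + 1) := by
  have hcl : IsClosed {x : C.W (k + 1) | (x, (0 : C.W (k + 1 + 1))) ∈ (C.d (k + 1)).graph} :=
    (C.d_closed (k + 1)).preimage (Continuous.prodMk_left (0 : C.W (k + 1 + 1)))
  have hsub : ((C.coboundaries k : Submodule ℝ (C.W (k + 1))) : Set (C.W (k + 1))) ⊆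
      {x : C.W (k + 1) | (x, (0 : C.W (k + 1 + 1))) ∈ (C.d (k + 1)).graph} := by
    rintro _ ⟨v, rfl⟩
    exact (LinearPMap.mem_graph_iff _).2 ⟨⟨C.dWₗ k v, C.d_mem k v⟩, rfl, C.d_comp_d k v⟩
  have h := closure_minimal hsub hcl hb
  obtain ⟨y, hy, hy0⟩ := (LinearPMap.mem_graph_iff _).1 h
  have hyb : y = b := C.toW_injective (k := k + 1) hy
  rw [mem_cocycles_iff, ← hyb]
  exact hy0

theorem projB_mem_cocycles (u : C.V (k + 1)) : C.projB k u ∈ C.cocycles (k + 1) :=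
  mem_cocycles_of_toW_mem_closure (C.toW_projB_mem k u)

theorem harmonic_le_cocycles {q : C.V (k + 1)} (hq : q ∈ C.harmonic k) : q ∈ C.cocycles (k + 1) :=
  hq.1

theorem inner_closure_coboundaries_harmonic {b : C.W (k + 1)}
    (hb : b ∈ (C.coboundaries k).topologicalClosure) {q : C.V (k + 1)} (hq : q ∈ C.harmonic k) :
    inner ℝ b (C.toW (k + 1) q) = 0 := by
  have h : C.toW (k + 1) q ∈ ((C.coboundaries k).topologicalClosure)ᗮ := by
    rw [Submodule.orthogonal_closure]
    exact hq.2
  exact (Submodule.mem_orthogonal _ _).1 h b hb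

theorem inner_dW_harmonic (τ : C.V k) {q : C.V (k + 1)} (hq : q ∈ C.harmonic k) :
    inner ℝ (C.dW k τ) (C.toW (k + 1) q) = 0 :=
  inner_closure_coboundaries_harmonic
    ((C.coboundaries k).le_topologicalClosure (dW_mem_coboundaries τ)) hq

theorem sub_projB_mem_harmonic {z : C.V (k + 1)} (hz : z ∈ C.cocycles (k + 1)) :
    z - C.projB k z ∈ C.harmonic k := by
  refine ⟨Submodule.sub_mem _ hz (projB_mem_cocycles z), ?_⟩
  rw [← Submodule.orthogonal_closure]
  exact Submodule.sub_starProjection_mem_orthogonal (K := (C.coboundaries k).topologicalClosure)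
    (C.toW (k + 1) z)

/-- The `W`-orthogonal projection onto the harmonic space. -/
noncomputable def harmPart (u : C.V (k + 1)) : C.V (k + 1) :=
  (C.cocycles (k + 1)).starProjection u - C.projB k ((C.cocycles (k + 1)).starProjection u)

theorem harmPart_mem (u : C.V (k + 1)) : harmPart u ∈ C.harmonic k :=
  sub_projB_mem_harmonic (Submodule.starProjection_apply_mem _ _)

theorem harmPart_of_mem_cocycles {z : C.V (k + 1)} (hz : z ∈ C.cocycles (k + 1)) :
    harmPart z = z - C.projB k z := by
  rw [harmPart, Submodule.starProjection_eq_self_iff.2 hz]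

/-- The `V`- and `W`-products agree once one factor is a cocycle, so the `V`-orthogonal projection
onto the cocycles is also `W`-orthogonal. -/
theorem inner_sub_starProjection_cocycle (u : C.V k) {z : C.V k} (hz : z ∈ C.cocycles k) :
    inner ℝ (C.toW k (u - (C.cocycles k).starProjection u)) (C.toW k z) = 0 := by
  rw [← inner_cocycle_right hz]
  exact Submodule.starProjection_inner_eq_zero _ _ hz

theorem inner_harmPart (u : C.V (k + 1)) {q : C.V (k + 1)} (hq : q ∈ C.harmonic k) :
    inner ℝ (C.toW (k + 1) (harmPart u)) (C.toW (k + 1) q) =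
      inner ℝ (C.toW (k + 1) u) (C.toW (k + 1) q) := by
  have h1 := inner_sub_starProjection_cocycle u (harmonic_le_cocycles hq)
  have h2 := inner_closure_coboundaries_harmonic
    (C.toW_projB_mem k ((C.cocycles (k + 1)).starProjection u)) hq
  rw [map_sub, inner_sub_left] at h1
  rw [harmPart, map_sub, inner_sub_left, h2]
  linarith

theorem norm_toW_harmPart_le (u : C.V (k + 1)) :
    ‖C.toW (k + 1) (harmPart u)‖ ≤ ‖C.toW (k + 1) u‖ := by
  have h := inner_harmPart u (harmPart_mem u)
  rw [real_inner_self_eq_norm_sq] at h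
  exact le_of_sq_le_mul_self (norm_nonneg _) (norm_nonneg _) (h ▸ real_inner_le_norm _ _)

/-- The cocycle part of an element orthogonal to the harmonic space lies in the closure of the
coboundaries. -/
theorem toW_starProjection_mem_closure {u : C.V (k + 1)}
    (hu : ∀ q ∈ C.harmonic k, inner ℝ (C.toW (k + 1) u) (C.toW (k + 1) q) = 0) :
    C.toW (k + 1) ((C.cocycles (k + 1)).starProjection u) ∈
      (C.coboundaries k).topologicalClosure := by
  have h0 : harmPart u = 0 := by
    have h := inner_harmPart u (harmPart_mem u)
    rw [hu _ (harmPart_mem u)] at h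
    exact C.toW_injective (by rw [inner_self_eq_zero.1 h, map_zero])
  rw [harmPart, sub_eq_zero] at h0
  rw [h0]
  exact C.toW_projB_mem k _

end Projections

/-! ### Stability of the mixed problem. -/

/-- Both sides are continuous in `x`. Working with the closure allows stability to be used in the
discrete complex, which is not assumed closed. -/
theorem abs_inner_closure_coboundaries_le {y : C.W (k + 1)} {a : ℝ}
    (h : ∀ τ : C.V k, |inner ℝ y (C.dW k τ)| ≤ a * ‖C.dW k τ‖) {x : C.W (k + 1)}
    (hx : x ∈ (C.coboundaries k).topologicalClosure) : |inner ℝ y x| ≤ a * ‖x‖ := by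
  have hcl : IsClosed {x : C.W (k + 1) | |inner ℝ y x| ≤ a * ‖x‖} :=
    isClosed_le (by fun_prop) (by fun_prop)
  refine closure_minimal ?_ hcl hx
  rintro _ ⟨τ, rfl⟩
  exact h τ

/-- If `S > 10 c² ε`, then `ε < S / 10` and the right side is at most `9.9 c² ε S`, which is less
than `S²`. -/
theorem le_of_sq_le_mul_add {S c ε : ℝ} (hc : 1 ≤ c) (hε : 0 ≤ ε)
    (h : S ^ 2 ≤ 9 * c ^ 2 * ε * (S + ε)) : S ≤ 10 * c ^ 2 * ε := by
  by_contra! hlt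
  have hc2 : 1 ≤ c ^ 2 := one_le_pow₀ hc
  have h1 : ε ≤ c ^ 2 * ε := by nlinarith
  have hS : 0 < S := by nlinarith
  have h2 : S + ε ≤ 11 / 10 * S := by linarith
  have h3 : 9 * c ^ 2 * ε * (S + ε) ≤ 9 * c ^ 2 * ε * (11 / 10 * S) :=
    mul_le_mul_of_nonneg_left h2 (by positivity)
  nlinarith

/-- Stability of the mixed problem with a monotone Lipschitz perturbation. -/
theorem mixed_stability {c ε : ℝ} (hc : 1 ≤ c) (hε : 0 ≤ ε)
    (hP : C.PoincareBound k c) (hP' : C.PoincareBound (k + 1) c)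
    {s : C.V k} {e p : C.V (k + 1)} {φ : C.W (k + 1)} (hp : p ∈ C.harmonic k)
    (he : ∀ q ∈ C.harmonic k, inner ℝ (C.toW (k + 1) e) (C.toW (k + 1) q) = 0)
    (hφ : 0 ≤ inner ℝ φ (C.toW (k + 1) (e + p))) (hφ' : ‖φ‖ ≤ c * ‖e + p‖)
    (h1 : ∀ τ : C.V k,
      |inner ℝ (C.toW k s) (C.toW k τ) - inner ℝ (C.toW (k + 1) e) (C.dW k τ)| ≤ ε * ‖τ‖)
    (h2 : ∀ v : C.V (k + 1),
      |inner ℝ (C.dW k s) (C.toW (k + 1) v) + inner ℝ (C.dW (k + 1) e) (C.dW (k + 1) v)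
        + inner ℝ (C.toW (k + 1) p) (C.toW (k + 1) v) + inner ℝ φ (C.toW (k + 1) v)|
        ≤ ε * ‖v‖) :
    ‖s‖ + ‖e‖ + ‖p‖ ≤ 44 * c ^ 4 * ε := by
  have hpZ := harmonic_le_cocycles hp
  set z := (C.cocycles (k + 1)).starProjection e with hz
  have hzZ : z ∈ C.cocycles (k + 1) := Submodule.starProjection_apply_mem _ _
  have hzB := toW_starProjection_mem_closure he
  rw [← hz] at hzB
  -- the component of `e` in the closure of the coboundaries
  have hB : ‖C.toW (k + 1) z‖ ≤ c * (‖C.toW k s‖ + ε) := by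
    have hb : ∀ τ : C.V k, |inner ℝ (C.toW (k + 1) e) (C.dW k τ)| ≤
        (c * (‖C.toW k s‖ + ε)) * ‖C.dW k τ‖ := by
      intro τ
      -- Same differential as `τ`, but with norm controlled by it, so the first equation bounds the
      -- pairing of `e` with coboundaries.
      set τ' := τ - (C.cocycles k).starProjection τ with hτ'
      have hd : C.dW k τ' = C.dW k τ :=
        dW_sub_cocycle τ ((C.cocycles k).starProjection_apply_mem τ)
      have hn : ‖τ'‖ ≤ c * ‖C.dW k τ‖ := hP.norm_sub_starProjection_le τ
      have h := h1 τ'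
      rw [hd] at h
      have h3 := abs_real_inner_le_norm (C.toW k s) (C.toW k τ')
      have h4 := mul_le_mul_of_nonneg_left (C.norm_toW_le τ') (norm_nonneg (C.toW k s))
      have h5 := mul_le_mul_of_nonneg_left hn (add_nonneg (norm_nonneg (C.toW k s)) hε)
      rw [abs_le] at h h3 ⊢
      constructor <;> nlinarith
    have h := abs_inner_closure_coboundaries_le hb hzB
    have hez : inner ℝ (C.toW (k + 1) e) (C.toW (k + 1) z) = ‖C.toW (k + 1) z‖ ^ 2 := by
      have h0 := inner_sub_starProjection_cocycle e hzZ
      rw [map_sub, inner_sub_left, ← hz, real_inner_self_eq_norm_sq] at h0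
      linarith
    rw [hez, abs_of_nonneg (sq_nonneg _)] at h
    exact le_of_sq_le_mul_self (norm_nonneg _) (by positivity) h
  have hw : ‖e - z‖ ≤ c * ‖C.dW (k + 1) e‖ := hP'.norm_sub_starProjection_le e
  have hE : ‖e‖ ≤ c * (‖C.toW k s‖ + ‖C.dW (k + 1) e‖ + ε) := by
    have h := norm_add_le (e - z) z
    rw [sub_add_cancel, norm_cocycle hzZ] at h
    linarith
  have hpn := norm_cocycle hpZ
  -- the energy identity
  have hen : ‖C.toW k s‖ ^ 2 + ‖C.dW (k + 1) e‖ ^ 2 + ‖p‖ ^ 2 ≤ ε * ‖e + p‖ + ε * ‖s‖ := by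
    -- Testing with `e + p` and `s` cancels the pairing of `d s` with `e`; the terms coupling `p` to
    -- `d s` and `e` vanish by orthogonality, and the nonlinear term is dropped by its sign.
    have h3 := (abs_le.1 (h2 (e + p))).2
    have h4 := (abs_le.1 (h1 s)).2
    have h5 := inner_dW_harmonic s hp
    have h6 := he p hp
    have h7 := (real_inner_comm (C.toW (k + 1) e) (C.toW (k + 1) p)).trans h6
    have h8 := real_inner_comm (C.toW (k + 1) e) (C.dW k s)
    rw [map_add (C.dW (k + 1)), mem_cocycles_iff.1 hpZ, add_zero, map_add, inner_add_right,
      inner_add_right (C.toW (k + 1) p), h5, h7, real_inner_self_eq_norm_sq,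
      real_inner_self_eq_norm_sq, ← map_add, ← hpn] at h3
    rw [real_inner_self_eq_norm_sq] at h4
    linarith
  have hds : ‖C.dW k s‖ ≤ ε + c * ‖e + p‖ := by
    -- With test function `d s` the `d e` and harmonic terms vanish, leaving only `‖d s‖²` and the
    -- nonlinear term.
    have h3 := (abs_le.1 (h2 (C.dV k s))).2
    rw [norm_cocycle (dV_mem_cocycles s), dW_dV, toW_dV, inner_zero_right,
      real_inner_self_eq_norm_sq, real_inner_comm, inner_dW_harmonic s hp] at h3
    have h4 := (abs_le.1 (abs_real_inner_le_norm φ (C.dW k s))).1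
    have h5 := mul_le_mul_of_nonneg_right hφ' (norm_nonneg (C.dW k s))
    refine le_of_sq_le_mul_self (norm_nonneg _) (by positivity) ?_
    linarith
  have hep := norm_add_le e p
  have hs := C.norm_le_toW_add_dW s
  set S := ‖C.toW k s‖ + ‖C.dW (k + 1) e‖ + ‖p‖ with hS
  have hSε : 0 ≤ S + ε := by positivity
  have hN : ‖e + p‖ ≤ c * (S + ε) := by
    nlinarith [norm_nonneg p]
  have hs' : ‖s‖ ≤ (S + ε) + c * (c * (S + ε)) := by
    have := mul_le_mul_of_nonneg_left hN (zero_le_one.trans hc)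
    have := norm_nonneg p
    have := norm_nonneg (C.dW (k + 1) e)
    linarith
  have hc2 : c ≤ c ^ 2 := by nlinarith
  have hc4 : c ^ 2 ≤ c ^ 4 := pow_le_pow_right₀ hc (by norm_num)
  have hm1 : c * (S + ε) ≤ c ^ 2 * (S + ε) := mul_le_mul_of_nonneg_right hc2 hSε
  have hm2 : S + ε ≤ c ^ 2 * (S + ε) := by nlinarith
  have hS2 : S ≤ 10 * c ^ 2 * ε := by
    refine le_of_sq_le_mul_add hc hε ?_
    have h3 : S ^ 2 ≤ 3 * (‖C.toW k s‖ ^ 2 + ‖C.dW (k + 1) e‖ ^ 2 + ‖p‖ ^ 2) := by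
      rw [hS]
      nlinarith [sq_nonneg (‖C.toW k s‖ - ‖C.dW (k + 1) e‖), sq_nonneg (‖C.toW k s‖ - ‖p‖),
        sq_nonneg (‖C.dW (k + 1) e‖ - ‖p‖)]
    have h4 : ‖e + p‖ + ‖s‖ ≤ 3 * (c ^ 2 * (S + ε)) := by linarith
    have h5 := mul_le_mul_of_nonneg_left h4 hε
    linarith
  have hfin : ‖s‖ + ‖e‖ + ‖p‖ ≤ 4 * (c ^ 2 * (S + ε)) := by
    have h3 : ‖e‖ ≤ c * (S + ε) := hE.trans (by
      refine mul_le_mul_of_nonneg_left ?_ (by linarith)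
      linarith [norm_nonneg p])
    have h4 : ‖p‖ ≤ S + ε := by linarith [norm_nonneg (C.toW k s), norm_nonneg (C.dW (k + 1) e)]
    linarith
  have h11 : S + ε ≤ 11 * c ^ 2 * ε := by nlinarith
  have := mul_le_mul_of_nonneg_left h11 (sq_nonneg c)
  linarith

end HilbertComplex

/-! ### Discretizations: transfer of cocycles, discrete Poincaré inequality, inner product defect.
-/

namespace HilbertComplex.Discretization

variable {C : HilbertComplex.{u}} {D : HilbertComplex.{v}} (A : C.Discretization D) {k : ℤ}

theorem toW_onV (v : D.V k) : C.toW k (A.i.onV k v) = A.i.toFun k (D.toW k v) := rfl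

theorem dW_onV (v : D.V k) : C.dW k (A.i.onV k v) = A.i.toFun (k + 1) (D.dW k v) :=
  A.i.dWₗ_onVₗ k v

theorem toW_sub_onV (x : C.V k) (v : D.V k) :
    C.toW k (x - A.i.onV k v) = C.toW k x - A.i.toFun k (D.toW k v) := by
  rw [map_sub, toW_onV]

theorem dW_sub_onV (x : C.V k) (v : D.V k) :
    C.dW k (x - A.i.onV k v) = C.dW k x - A.i.toFun (k + 1) (D.dW k v) := by
  rw [map_sub, dW_onV]

theorem onV_mem_cocycles {v : D.V k} (hv : v ∈ D.cocycles k) : A.i.onV k v ∈ C.cocycles k := by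
  rw [mem_cocycles_iff, dW_onV, mem_cocycles_iff.1 hv, map_zero]

theorem dW_π (v : C.V k) : D.dW k (A.π k v) = D.toW (k + 1) (A.π (k + 1) (C.dV k v)) := by
  rw [A.π_comm, toW_dV]

theorem π_mem_cocycles {z : C.V k} (hz : z ∈ C.cocycles k) : A.π k z ∈ D.cocycles k := by
  have h : C.dV k z = 0 := hz
  rw [mem_cocycles_iff, dW_π, h, map_zero, map_zero]

theorem toFun_mem_closure_coboundaries {b : D.W (k + 1)}
    (hb : b ∈ (D.coboundaries k).topologicalClosure) :
    A.i.toFun (k + 1) b ∈ (C.coboundaries k).topologicalClosure := by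
  have hcl : IsClosed {x | A.i.toFun (k + 1) x ∈ (C.coboundaries k).topologicalClosure} :=
    (Submodule.isClosed_topologicalClosure _).preimage (A.i.toFun (k + 1)).continuous
  refine closure_minimal ?_ hcl hb
  rintro _ ⟨τ, rfl⟩
  have h := dW_mem_coboundaries (A.i.onV k τ)
  rw [dW_onV] at h
  exact (C.coboundaries k).le_topologicalClosure h

theorem toW_π_mem_coboundaries {b : C.V (k + 1)}
    (hb : C.toW (k + 1) b ∈ C.coboundaries k) :
    D.toW (k + 1) (A.π (k + 1) b) ∈ D.coboundaries k := by
  obtain ⟨η, hη⟩ := hb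
  have h : C.dV k η = b := C.toW_injective (k := k + 1) hη
  rw [← h, ← dW_π]
  exact dW_mem_coboundaries _

/-- Bounds on the operators of a discretization in the degrees `k`, `k + 1`, `k + 2`, with Poincaré
inequalities in degrees `k` and `k + 1`, by a common constant. -/
structure IsBoundedBy (A : C.Discretization D) (k : ℤ) (M : ℝ) : Prop where
  one_le : 1 ≤ M
  closed : C.IsClosedComplex
  norm_i_zero : ‖A.i.toFun k‖ ≤ M
  norm_i_one : ‖A.i.toFun (k + 1)‖ ≤ M
  norm_i_two : ‖A.i.toFun (k + 1 + 1)‖ ≤ M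
  norm_π_zero : ‖A.π k‖ ≤ M
  norm_π_one : ‖A.π (k + 1)‖ ≤ M
  poincare_zero : C.PoincareBound k M
  poincare_one : C.PoincareBound (k + 1) M

variable {A} {M : ℝ}

/-- Comparing squares gives the constant `M` instead of the sum of two norms in the definition of
`onV`. -/
theorem norm_onV_le (hM : 0 ≤ M) (h0 : ‖A.i.toFun k‖ ≤ M) (h1 : ‖A.i.toFun (k + 1)‖ ≤ M)
    (v : D.V k) : ‖A.i.onV k v‖ ≤ M * ‖v‖ := by
  refine abs_le_of_sq_le_sq' ?_ (by positivity) |>.2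
  have e1 : ‖A.i.onV k v‖ ^ 2 =
      ‖A.i.toFun k (D.toW k v)‖ ^ 2 + ‖A.i.toFun (k + 1) (D.dW k v)‖ ^ 2 := by
    rw [← dW_onV, ← toW_onV]
    exact C.norm_V_sq k _
  have e2 : ‖v‖ ^ 2 = ‖D.toW k v‖ ^ 2 + ‖D.dW k v‖ ^ 2 := D.norm_V_sq k v
  have h2 := pow_le_pow_left₀ (norm_nonneg _)
    ((A.i.toFun k).le_of_opNorm_le h0 (D.toW k v)) 2
  have h3 := pow_le_pow_left₀ (norm_nonneg _)
    ((A.i.toFun (k + 1)).le_of_opNorm_le h1 (D.dW k v)) 2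
  rw [e1, mul_pow, e2, mul_add, ← mul_pow, ← mul_pow]
  exact add_le_add h2 h3

/-- The discrete Poincaré inequality. -/
theorem poincareBound_of_bounds (hM : 0 ≤ M) (hi : ‖A.i.toFun (k + 1)‖ ≤ M) (hπ : ‖A.π k‖ ≤ M)
    (hP : C.PoincareBound k M) : D.PoincareBound k (M ^ 3) := by
  intro v hv
  set z := A.i.onV k v - (C.cocycles k).starProjection (A.i.onV k v) with hz
  have hzn : ‖z‖ ≤ M * (M * ‖D.dW k v‖) := by
    have h1 := hP.norm_sub_starProjection_le (A.i.onV k v)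
    rw [dW_onV] at h1
    exact h1.trans (mul_le_mul_of_nonneg_left
      ((A.i.toFun (k + 1)).le_of_opNorm_le hi _) hM)
  -- This difference is `π` of the cocycle part of `i v`. Being orthogonal to `v`, it yields `‖v‖ ≤
  -- ‖π z‖`.
  have hmem : v - A.π k z ∈ D.cocycles k := by
    have h1 := A.π_mem_cocycles
      ((C.cocycles k).starProjection_apply_mem (A.i.onV k v))
    rw [hz, map_sub, A.π_i, sub_sub_cancel]
    exact h1
  have h0 : inner ℝ (v - A.π k z) v = 0 := (Submodule.mem_orthogonal _ _).1 hv _ hmem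
  rw [inner_sub_left, real_inner_self_eq_norm_sq] at h0
  have h1 := real_inner_le_norm (A.π k z) v
  have h2 := le_of_sq_le_mul_self (norm_nonneg v) (norm_nonneg (A.π k z)) (by linarith)
  have h3 := (A.π k).le_of_opNorm_le hπ z
  calc ‖v‖ ≤ M * ‖z‖ := h2.trans h3
    _ ≤ M * (M * (M * ‖D.dW k v‖)) := mul_le_mul_of_nonneg_left hzn hM
    _ = M ^ 3 * ‖D.dW k v‖ := by ring

variable (A)

/-- The inner products of `W_h` and `W` differ by at most `‖I - J_h‖`. -/
theorem abs_inner_sub_inner_toFun_le (a y : D.W k) :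
    |inner ℝ a y - inner ℝ (A.i.toFun k a) (A.i.toFun k y)| ≤
      ‖ContinuousLinearMap.id ℝ (D.W k) - A.J k‖ * ‖a‖ * ‖y‖ := by
  have h : inner ℝ a y - inner ℝ (A.i.toFun k a) (A.i.toFun k y) =
      inner ℝ ((ContinuousLinearMap.id ℝ (D.W k) - A.J k) a) y := by
    rw [sub_apply, inner_sub_left, J, iAdj, ContinuousLinearMap.comp_apply,
      ContinuousLinearMap.adjoint_inner_left]
    rfl
  rw [h]
  exact (abs_real_inner_le_norm _ _).trans
    (mul_le_mul_of_nonneg_right (ContinuousLinearMap.le_opNorm _ _) (norm_nonneg _))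

theorem abs_inner_sub_inner_le {ω : ℝ}
    (hω : ‖ContinuousLinearMap.id ℝ (D.W k) - A.J k‖ ≤ ω) (hi : ‖A.i.toFun k‖ ≤ M)
    (x : C.W k) (a y : D.W k) :
    |inner ℝ a y - inner ℝ x (A.i.toFun k y)| ≤
      (ω * ‖a‖ + M * ‖x - A.i.toFun k a‖) * ‖y‖ := by
  have h1 := A.abs_inner_sub_inner_toFun_le a y
  have h2 := abs_real_inner_le_norm (x - A.i.toFun k a) (A.i.toFun k y)
  have h3 := mul_le_mul_of_nonneg_left ((A.i.toFun k).le_of_opNorm_le hi y)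
    (norm_nonneg (x - A.i.toFun k a))
  have h4 : ‖ContinuousLinearMap.id ℝ (D.W k) - A.J k‖ * ‖a‖ * ‖y‖ ≤ ω * ‖a‖ * ‖y‖ := by gcongr
  rw [inner_sub_left] at h2
  rw [abs_le] at h1 h2 ⊢
  constructor <;> linarith

theorem crime_zero : ‖ContinuousLinearMap.id ℝ (D.W k) - A.J k‖ ≤ A.crime k := le_max_left _ _

theorem crime_one : ‖ContinuousLinearMap.id ℝ (D.W (k + 1)) - A.J (k + 1)‖ ≤ A.crime k :=
  (le_max_left _ _).trans (le_max_right _ _)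

theorem crime_two :
    ‖ContinuousLinearMap.id ℝ (D.W (k + 1 + 1)) - A.J (k + 1 + 1)‖ ≤ A.crime k :=
  (le_max_right _ _).trans (le_max_right _ _)

theorem crime_nonneg : 0 ≤ A.crime k := (norm_nonneg _).trans A.crime_zero

theorem mu_nonneg : 0 ≤ A.mu k := Real.iSup_nonneg fun _ => norm_nonneg _

end HilbertComplex.Discretization

/-! ### Quasi-optimality and the gap between harmonic spaces. -/

namespace HilbertComplex

variable {C : HilbertComplex.{u}} {k : ℤ}

theorem IsClosedComplex.topologicalClosure_coboundaries (hC : C.IsClosedComplex) (k : ℤ) :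
    (C.coboundaries k).topologicalClosure = C.coboundaries k := by
  refine IsClosed.submodule_topologicalClosure_eq ?_
  have h : ((C.coboundaries k : Submodule ℝ (C.W (k + 1))) : Set (C.W (k + 1))) =
      Set.range (C.d k) := rfl
  rw [h]
  exact hC k

theorem inner_toW_projB_comm (u w : C.V (k + 1)) :
    inner ℝ (C.toW (k + 1) u) (C.toW (k + 1) (C.projB k w)) =
      inner ℝ (C.toW (k + 1) (C.projB k u)) (C.toW (k + 1) (C.projB k w)) := by
  have h := Submodule.starProjection_inner_eq_zero (K := (C.coboundaries k).topologicalClosure)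
    (C.toW (k + 1) u) _ (C.toW_projB_mem k w)
  rw [inner_sub_left] at h
  rw [toW_projB C k u]
  linarith

namespace Discretization.IsBoundedBy

variable {D : HilbertComplex.{v}} {A : C.Discretization D} {M : ℝ}

theorem nonneg (h : A.IsBoundedBy k M) : 0 ≤ M := zero_le_one.trans h.one_le

theorem discrete_poincare_zero (h : A.IsBoundedBy k M) : D.PoincareBound k (M ^ 3) :=
  poincareBound_of_bounds h.nonneg h.norm_i_one h.norm_π_zero h.poincare_zero

theorem discrete_poincare_one (h : A.IsBoundedBy k M) : D.PoincareBound (k + 1) (M ^ 3) :=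
  poincareBound_of_bounds h.nonneg h.norm_i_two h.norm_π_one h.poincare_one

theorem norm_onV_zero (h : A.IsBoundedBy k M) (v : D.V k) : ‖A.i.onV k v‖ ≤ M * ‖v‖ :=
  norm_onV_le h.nonneg h.norm_i_zero h.norm_i_one v

theorem norm_onV_one (h : A.IsBoundedBy k M) (v : D.V (k + 1)) :
    ‖A.i.onV (k + 1) v‖ ≤ M * ‖v‖ :=
  norm_onV_le h.nonneg h.norm_i_one h.norm_i_two v

theorem norm_π_zero_apply (h : A.IsBoundedBy k M) (x : C.V k) : ‖A.π k x‖ ≤ M * ‖x‖ :=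
  (A.π k).le_of_opNorm_le h.norm_π_zero x

theorem norm_π_one_apply (h : A.IsBoundedBy k M) (x : C.V (k + 1)) :
    ‖A.π (k + 1) x‖ ≤ M * ‖x‖ :=
  (A.π (k + 1)).le_of_opNorm_le h.norm_π_one x

theorem norm_toFun_one (h : A.IsBoundedBy k M) (x : D.W (k + 1)) :
    ‖A.i.toFun (k + 1) x‖ ≤ M * ‖x‖ :=
  (A.i.toFun (k + 1)).le_of_opNorm_le h.norm_i_one x

/-- A projection that is bounded by `M ^ 2` is quasi-optimal. -/
theorem norm_sub_onV_π_le_iInf {j : ℤ} (hM : 1 ≤ M) (hi : ∀ v, ‖A.i.onV j v‖ ≤ M * ‖v‖)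
    (hπ : ∀ x, ‖A.π j x‖ ≤ M * ‖x‖) (x : C.V j) :
    ‖x - A.i.onV j (A.π j x)‖ ≤ 2 * M ^ 2 * ⨅ v, ‖x - A.i.onV j v‖ := by
  have hM0 : 0 ≤ M := zero_le_one.trans hM
  rw [Real.mul_iInf_of_nonneg (by positivity)]
  refine le_ciInf fun v => ?_
  -- `I - i π` vanishes on the image of `i`, and its norm is at most `1 + M² ≤ 2 M²`.
  have e : x - A.i.onV j (A.π j x) =
      (x - A.i.onV j v) - A.i.onV j (A.π j (x - A.i.onV j v)) := by
    simp only [map_sub, A.π_i]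
    abel
  have h1 := norm_sub_le (x - A.i.onV j v) (A.i.onV j (A.π j (x - A.i.onV j v)))
  have h2 := (hi (A.π j (x - A.i.onV j v))).trans
    (mul_le_mul_of_nonneg_left (hπ (x - A.i.onV j v)) hM0)
  rw [← e] at h1
  have h3 : ‖x - A.i.onV j v‖ ≤ M ^ 2 * ‖x - A.i.onV j v‖ :=
    le_mul_of_one_le_left (norm_nonneg _) (one_le_pow₀ hM)
  linarith

theorem quasiopt_zero (h : A.IsBoundedBy k M) (x : C.V k) :
    ‖x - A.i.onV k (A.π k x)‖ ≤ 2 * M ^ 2 * ⨅ v, ‖x - A.i.onV k v‖ :=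
  norm_sub_onV_π_le_iInf h.one_le h.norm_onV_zero h.norm_π_zero_apply x

theorem quasiopt_one (h : A.IsBoundedBy k M) (x : C.V (k + 1)) :
    ‖x - A.i.onV (k + 1) (A.π (k + 1) x)‖ ≤ 2 * M ^ 2 * ⨅ v, ‖x - A.i.onV (k + 1) v‖ :=
  norm_sub_onV_π_le_iInf h.one_le h.norm_onV_one h.norm_π_one_apply x

theorem norm_sub_onV_π_le (h : A.IsBoundedBy k M) (x : C.V (k + 1)) :
    ‖x - A.i.onV (k + 1) (A.π (k + 1) x)‖ ≤ 2 * M ^ 2 * ‖x‖ := by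
  have hM := h.nonneg
  refine (h.quasiopt_one x).trans (mul_le_mul_of_nonneg_left ?_ (by positivity))
  refine (ciInf_le ⟨0, ?_⟩ 0).trans (by rw [map_zero, sub_zero])
  rintro _ ⟨v, rfl⟩
  exact norm_nonneg _

theorem norm_le_mu (h : A.IsBoundedBy k M) {r : C.V (k + 1)} (hr : r ∈ C.harmonic k) :
    ‖C.toW (k + 1) (r - A.i.onV (k + 1) (A.π (k + 1) r))‖ ≤ A.mu k * ‖C.toW (k + 1) r‖ := by
  rcases eq_or_ne r 0 with rfl | h0
  · simp
  have hpos : 0 < ‖C.toW (k + 1) r‖ := by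
    rw [norm_pos_iff]
    exact fun h1 => h0 (C.toW_injective (by rw [h1, map_zero]))
  set t := ‖C.toW (k + 1) r‖ with ht
  -- Without boundedness the real supremum defining `mu` would take the default value `0`.
  have hbdd : BddAbove (Set.range fun r : {r : C.V (k + 1) // r ∈ C.harmonic k ∧
      ‖C.toW (k + 1) r‖ = 1} => ‖C.toW (k + 1) (r.1 - A.i.onV (k + 1) (A.π (k + 1) r.1))‖) := by
    refine ⟨2 * M ^ 2, ?_⟩
    rintro _ ⟨⟨s, hs, hs1⟩, rfl⟩
    have h1 := h.norm_sub_onV_π_le s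
    rw [norm_cocycle (harmonic_le_cocycles hs), hs1, mul_one] at h1
    exact (C.norm_toW_le _).trans h1
  have h1 := le_ciSup hbdd ⟨t⁻¹ • r, Submodule.smul_mem _ _ hr, by
    rw [map_smul, norm_smul, norm_inv, norm_norm, ← ht, inv_mul_cancel₀ hpos.ne']⟩
  simp only [map_smul, ← smul_sub, norm_smul, norm_inv, Real.norm_eq_abs, abs_of_pos hpos] at h1
  rw [← div_le_iff₀ hpos, div_eq_inv_mul]
  exact h1

/-- The gap between the discrete and the continuous harmonic spaces. -/
theorem norm_sub_harmPart_le (h : A.IsBoundedBy k M) {q : D.V (k + 1)} (hq : q ∈ D.harmonic k) :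
    ‖C.toW (k + 1) (C.projB k (A.i.onV (k + 1) q))‖ ≤
      (A.mu k * M + M * A.crime k) * ‖D.toW (k + 1) q‖ := by
  have hM := h.nonneg
  set x := A.i.onV (k + 1) q with hx
  have hxZ : x ∈ C.cocycles (k + 1) := A.onV_mem_cocycles (harmonic_le_cocycles hq)
  set b := C.projB k x with hb
  set r : C.V (k + 1) := harmPart x with hr
  have hrH : r ∈ C.harmonic k := harmPart_mem x
  have hbr : b = x - r := by rw [hr, harmPart_of_mem_cocycles hxZ, sub_sub_cancel]
  have hbB : C.toW (k + 1) b ∈ (C.coboundaries k).topologicalClosure := C.toW_projB_mem k x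
  have hbZ : b ∈ C.cocycles (k + 1) := projB_mem_cocycles x
  -- Closedness makes `b` an actual coboundary `d η`, so `π b = d (π η)`.
  have hπB : D.toW (k + 1) (A.π (k + 1) b) ∈ (D.coboundaries k).topologicalClosure := by
    refine (D.coboundaries k).le_topologicalClosure (A.toW_π_mem_coboundaries ?_)
    rwa [h.closed.topologicalClosure_coboundaries] at hbB
  have hsplit : b = A.i.onV (k + 1) (A.π (k + 1) b) -
      (r - A.i.onV (k + 1) (A.π (k + 1) r)) := by
    rw [hbr, map_sub, map_sub, hx, A.π_i]
    abel
  -- `r` is orthogonal to `i π b`, and `q` is discretely orthogonal to `π b`, so only the inner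
  -- product defect remains. The other term of `hsplit` is measured by `mu`.
  have h1 : inner ℝ (C.toW (k + 1) b) (C.toW (k + 1) (A.i.onV (k + 1) (A.π (k + 1) b))) ≤
      A.crime k * ‖D.toW (k + 1) q‖ * (M * ‖C.toW (k + 1) b‖) := by
    have e1 := inner_closure_coboundaries_harmonic (A.toFun_mem_closure_coboundaries hπB) hrH
    rw [real_inner_comm] at e1
    have e2 := inner_closure_coboundaries_harmonic hπB hq
    rw [real_inner_comm] at e2
    have e3 := A.abs_inner_sub_inner_toFun_le (D.toW (k + 1) q) (D.toW (k + 1) (A.π (k + 1) b))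
    rw [e2, zero_sub, abs_neg] at e3
    have e4 : ‖D.toW (k + 1) (A.π (k + 1) b)‖ ≤ M * ‖C.toW (k + 1) b‖ := by
      rw [← norm_cocycle hbZ]
      exact (D.norm_toW_le _).trans (h.norm_π_one_apply b)
    have e5 := A.crime_one (k := k)
    have e6 : inner ℝ (C.toW (k + 1) b) (C.toW (k + 1) (A.i.onV (k + 1) (A.π (k + 1) b))) =
        inner ℝ (A.i.toFun (k + 1) (D.toW (k + 1) q))
          (A.i.toFun (k + 1) (D.toW (k + 1) (A.π (k + 1) b))) := by
      rw [toW_onV, ← toW_onV A q, ← hx, ← sub_add_cancel x r, ← hbr, map_add, inner_add_left,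
        e1, add_zero]
    rw [e6]
    refine (le_of_abs_le e3).trans ?_
    have e7 := A.crime_nonneg (k := k)
    gcongr
  have h2 : -inner ℝ (C.toW (k + 1) b) (C.toW (k + 1) (r - A.i.onV (k + 1) (A.π (k + 1) r))) ≤
      ‖C.toW (k + 1) b‖ * (A.mu k * (M * ‖D.toW (k + 1) q‖)) := by
    have e1 := (abs_le.1 (abs_real_inner_le_norm (C.toW (k + 1) b)
      (C.toW (k + 1) (r - A.i.onV (k + 1) (A.π (k + 1) r))))).1
    have e2 : ‖C.toW (k + 1) r‖ ≤ M * ‖D.toW (k + 1) q‖ :=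
      (norm_toW_harmPart_le x).trans (h.norm_toFun_one _)
    have e3 := (h.norm_le_mu hrH).trans (mul_le_mul_of_nonneg_left e2 A.mu_nonneg)
    have e4 := mul_le_mul_of_nonneg_left e3 (norm_nonneg (C.toW (k + 1) b))
    linarith
  have hcrime := A.crime_nonneg (k := k)
  have hmu := A.mu_nonneg (k := k)
  refine le_of_sq_le_mul_self (norm_nonneg _) (by positivity) ?_
  have h3 : ‖C.toW (k + 1) b‖ ^ 2 =
      inner ℝ (C.toW (k + 1) b) (C.toW (k + 1) (A.i.onV (k + 1) (A.π (k + 1) b))) -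
      inner ℝ (C.toW (k + 1) b) (C.toW (k + 1) (r - A.i.onV (k + 1) (A.π (k + 1) r))) := by
    rw [← inner_sub_right, ← map_sub, ← hsplit, real_inner_self_eq_norm_sq]
  rw [h3]
  linarith

/-- Only the coboundary component of `i q` sees `u`, and there `u` may be replaced by `b = P_𝔅 u`.
Subtracting `i π b` produces the product of gap and approximation error; the rest pairs `i π b` with
`i q` and is a pure inner product defect, as `π b` is discretely orthogonal to `q`. -/
theorem abs_inner_toFun_harmonic_le (h : A.IsBoundedBy k M) {u : C.V (k + 1)}
    (hu : ∀ q ∈ C.harmonic k, inner ℝ (C.toW (k + 1) u) (C.toW (k + 1) q) = 0)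
    {q : D.V (k + 1)} (hq : q ∈ D.harmonic k) :
    |inner ℝ (C.toW (k + 1) u) (A.i.toFun (k + 1) (D.toW (k + 1) q))| ≤
      (M * (A.mu k * ‖C.projB k u - A.i.onV (k + 1) (A.π (k + 1) (C.projB k u))‖)
        + 4 * M ^ 3 * (A.crime k * ‖u‖)) * ‖D.toW (k + 1) q‖ := by
  have hM := h.nonneg
  have hcrime := A.crime_nonneg (k := k)
  have hmu := A.mu_nonneg (k := k)
  set x := A.i.onV (k + 1) q with hx
  have hxZ : x ∈ C.cocycles (k + 1) := A.onV_mem_cocycles (harmonic_le_cocycles hq)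
  set b := C.projB k u with hb
  have hbB : C.toW (k + 1) b ∈ (C.coboundaries k).topologicalClosure := C.toW_projB_mem k u
  have hbZ : b ∈ C.cocycles (k + 1) := projB_mem_cocycles u
  have hbu : ‖b‖ ≤ ‖u‖ := by
    rw [norm_cocycle hbZ]
    exact (norm_toW_projB_le u).trans (C.norm_toW_le u)
  have hπB : D.toW (k + 1) (A.π (k + 1) b) ∈ (D.coboundaries k).topologicalClosure := by
    refine (D.coboundaries k).le_topologicalClosure (A.toW_π_mem_coboundaries ?_)
    rwa [h.closed.topologicalClosure_coboundaries] at hbB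
  have hrH : x - C.projB k x ∈ C.harmonic k := sub_projB_mem_harmonic hxZ
  have e1 : inner ℝ (C.toW (k + 1) u) (A.i.toFun (k + 1) (D.toW (k + 1) q)) =
      inner ℝ (C.toW (k + 1) (b - A.i.onV (k + 1) (A.π (k + 1) b)))
        (C.toW (k + 1) (C.projB k x)) +
      inner ℝ (A.i.toFun (k + 1) (D.toW (k + 1) (A.π (k + 1) b)))
        (A.i.toFun (k + 1) (D.toW (k + 1) q)) := by
    have f1 := hu _ hrH
    have f2 := inner_closure_coboundaries_harmonic (A.toFun_mem_closure_coboundaries hπB) hrH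
    have f3 := inner_toW_projB_comm u x
    rw [map_sub, inner_sub_right] at f1 f2
    rw [toW_sub_onV, inner_sub_left, ← toW_onV, ← hx]
    linarith
  have e2 : |inner ℝ (C.toW (k + 1) (b - A.i.onV (k + 1) (A.π (k + 1) b)))
        (C.toW (k + 1) (C.projB k x))| ≤
      ‖b - A.i.onV (k + 1) (A.π (k + 1) b)‖ *
        ((A.mu k * M + M * A.crime k) * ‖D.toW (k + 1) q‖) :=
    (abs_real_inner_le_norm _ _).trans
      (mul_le_mul (C.norm_toW_le _) (h.norm_sub_harmPart_le hq) (norm_nonneg _) (norm_nonneg _))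
  have e3 : |inner ℝ (A.i.toFun (k + 1) (D.toW (k + 1) (A.π (k + 1) b)))
        (A.i.toFun (k + 1) (D.toW (k + 1) q))| ≤
      A.crime k * (M * ‖u‖) * ‖D.toW (k + 1) q‖ := by
    have f1 := A.abs_inner_sub_inner_toFun_le (D.toW (k + 1) (A.π (k + 1) b)) (D.toW (k + 1) q)
    rw [inner_closure_coboundaries_harmonic hπB hq, zero_sub, abs_neg] at f1
    have f2 : ‖D.toW (k + 1) (A.π (k + 1) b)‖ ≤ M * ‖u‖ :=
      ((D.norm_toW_le _).trans (h.norm_π_one_apply b)).trans (mul_le_mul_of_nonneg_left hbu hM)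
    refine f1.trans ?_
    have := A.crime_one (k := k)
    gcongr
  have e4 : ‖b - A.i.onV (k + 1) (A.π (k + 1) b)‖ * (M * A.crime k) ≤
      2 * M ^ 2 * ‖u‖ * (M * A.crime k) := by
    refine mul_le_mul_of_nonneg_right ((h.norm_sub_onV_π_le b).trans ?_) (by positivity)
    gcongr
  have e5 : M * (A.crime k * ‖u‖) ≤ M ^ 3 * (A.crime k * ‖u‖) :=
    mul_le_mul_of_nonneg_right (le_self_pow₀ h.one_le (by norm_num)) (by positivity)
  have e6 := mul_le_mul_of_nonneg_right e4 (norm_nonneg (D.toW (k + 1) q))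
  have e7 := mul_le_mul_of_nonneg_right e5 (norm_nonneg (D.toW (k + 1) q))
  have e8 : 0 ≤ M ^ 3 * (A.crime k * ‖u‖) * ‖D.toW (k + 1) q‖ := by positivity
  rw [e1]
  refine (abs_add_le _ _).trans ((add_le_add e2 e3).trans ?_)
  linarith

end Discretization.IsBoundedBy

end HilbertComplex

/-! ### A priori bound, consistency and the error estimate. -/

namespace HilbertComplex

variable {C : HilbertComplex.{u}} {k : ℤ}

/-- `F (u + p)` is counted as data, so stability applies with zero perturbation. -/
theorem IsMixedSolution.norm_le {F : C.V (k + 1) → C.W (k + 1)} {f : C.W (k + 1)} {σ : C.V k}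
    {u p : C.V (k + 1)} (hs : C.IsMixedSolution k F f σ u p) {c : ℝ} (hc : 1 ≤ c)
    (hP : C.PoincareBound k c) (hP' : C.PoincareBound (k + 1) c) :
    ‖σ‖ + ‖u‖ + ‖p‖ ≤ 44 * c ^ 4 * ‖f - F (u + p)‖ := by
  have hc0 : 0 ≤ c := zero_le_one.trans hc
  refine mixed_stability (φ := 0) hc (norm_nonneg _) hP hP' hs.harmonic_mem hs.eq_trd
    (by rw [inner_zero_left]) (by rw [norm_zero]; positivity) (fun τ => ?_) (fun v => ?_)
  · rw [hs.eq_fst τ, abs_zero]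
    positivity
  · have h1 := hs.eq_snd v
    have h2 : inner ℝ (C.dW k σ) (C.toW (k + 1) v) + inner ℝ (C.dW (k + 1) u) (C.dW (k + 1) v)
        + inner ℝ (C.toW (k + 1) p) (C.toW (k + 1) v) + inner ℝ 0 (C.toW (k + 1) v) =
        inner ℝ (f - F (u + p)) (C.toW (k + 1) v) := by
      rw [inner_sub_left, inner_zero_left]
      linarith
    rw [h2]
    exact (abs_real_inner_le_norm _ _).trans
      (mul_le_mul_of_nonneg_left (C.norm_toW_le v) (norm_nonneg _))

namespace Discretization

variable {D : HilbertComplex.{v}} {A : C.Discretization D} {M : ℝ}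

theorem abs_inner_toW_π_sub_le {ω : ℝ} (hM : 0 ≤ M)
    (hω : ‖ContinuousLinearMap.id ℝ (D.W k) - A.J k‖ ≤ ω) (hi : ‖A.i.toFun k‖ ≤ M)
    (hπ : ‖A.π k‖ ≤ M) (x : C.V k) (y : D.W k) :
    |inner ℝ (D.toW k (A.π k x)) y - inner ℝ (C.toW k x) (A.i.toFun k y)| ≤
      M * (ω * ‖x‖ + ‖x - A.i.onV k (A.π k x)‖) * ‖y‖ := by
  have hω0 := (norm_nonneg _).trans hω
  refine (A.abs_inner_sub_inner_le hω hi _ _ _).trans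
    (mul_le_mul_of_nonneg_right ?_ (norm_nonneg _))
  have h1 := mul_le_mul_of_nonneg_left
    ((D.norm_toW_le (A.π k x)).trans ((A.π k).le_of_opNorm_le hπ x)) hω0
  have h2 := mul_le_mul_of_nonneg_left (C.norm_toW_le (x - A.i.onV k (A.π k x))) hM
  rw [toW_sub_onV] at h2
  linarith

theorem abs_inner_dW_π_sub_le {ω : ℝ} (hM : 0 ≤ M)
    (hω : ‖ContinuousLinearMap.id ℝ (D.W (k + 1)) - A.J (k + 1)‖ ≤ ω)
    (hi : ‖A.i.toFun (k + 1)‖ ≤ M) (hπ : ‖A.π k‖ ≤ M) (x : C.V k) (y : D.W (k + 1)) :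
    |inner ℝ (D.dW k (A.π k x)) y - inner ℝ (C.dW k x) (A.i.toFun (k + 1) y)| ≤
      M * (ω * ‖x‖ + ‖x - A.i.onV k (A.π k x)‖) * ‖y‖ := by
  have hω0 := (norm_nonneg _).trans hω
  refine (A.abs_inner_sub_inner_le hω hi _ _ _).trans
    (mul_le_mul_of_nonneg_right ?_ (norm_nonneg _))
  have h1 := mul_le_mul_of_nonneg_left
    ((D.norm_dW_le (A.π k x)).trans ((A.π k).le_of_opNorm_le hπ x)) hω0
  have h2 := mul_le_mul_of_nonneg_left (C.norm_dW_le (x - A.i.onV k (A.π k x))) hM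
  rw [dW_sub_onV] at h2
  linarith

/-- `π` inverts `i` on the image, so the difference is `π` of the best approximation error, which is
at most that of `i π x`. -/
theorem norm_projVh_sub_π_le (hM : 0 ≤ M) (hπ : ‖A.π k‖ ≤ M) (x : C.V k) :
    ‖A.projVh k x - A.π k x‖ ≤ M * ‖x - A.i.onV k (A.π k x)‖ := by
  have h1 : A.projVh k x - A.π k x = A.π k ((A.image k).starProjection x - x) := by
    rw [map_sub]
    rfl
  rw [h1]
  refine ((A.π k).le_of_opNorm_le hπ _).trans (mul_le_mul_of_nonneg_left ?_ hM)
  rw [norm_sub_rev, Submodule.starProjection_minimal]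
  refine ciInf_le ⟨0, ?_⟩ (⟨A.i.onV k (A.π k x), A.π k x, rfl⟩ : A.image k)
  rintro _ ⟨v, rfl⟩
  exact norm_nonneg _

namespace IsBoundedBy

/-- `p` is orthogonal to `i b`, so testing `π p` with `b` leaves only consistency errors. -/
theorem norm_projB_π_le (h : A.IsBoundedBy k M) {p : C.V (k + 1)} (hp : p ∈ C.harmonic k) :
    ‖D.projB k (A.π (k + 1) p)‖ ≤
      M * (A.crime k * ‖p‖ + ‖p - A.i.onV (k + 1) (A.π (k + 1) p)‖) := by
  have hM := h.nonneg
  have hcrime := A.crime_nonneg (k := k)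
  set b := D.projB k (A.π (k + 1) p) with hb
  have hbB : D.toW (k + 1) b ∈ (D.coboundaries k).topologicalClosure := D.toW_projB_mem k _
  rw [norm_cocycle (projB_mem_cocycles (A.π (k + 1) p))]
  refine le_of_sq_le_mul_self (norm_nonneg _) (by positivity) ?_
  have h1 := A.abs_inner_toW_π_sub_le hM A.crime_one h.norm_i_one h.norm_π_one p
    (D.toW (k + 1) b)
  have h2 := inner_closure_coboundaries_harmonic (A.toFun_mem_closure_coboundaries hbB) hp
  rw [real_inner_comm] at h2
  rw [h2, sub_zero, hb, inner_toW_projB_comm, ← hb, real_inner_self_eq_norm_sq] at h1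
  exact le_of_abs_le h1

theorem norm_harmPart_π_le (h : A.IsBoundedBy k M) {u : C.V (k + 1)}
    (hu : ∀ q ∈ C.harmonic k, inner ℝ (C.toW (k + 1) u) (C.toW (k + 1) q) = 0) :
    ‖(harmPart (A.π (k + 1) u) : D.V (k + 1))‖ ≤
      M * (A.crime k * ‖u‖ + ‖u - A.i.onV (k + 1) (A.π (k + 1) u)‖) +
      (M * (A.mu k * ‖C.projB k u - A.i.onV (k + 1) (A.π (k + 1) (C.projB k u))‖)
        + 4 * M ^ 3 * (A.crime k * ‖u‖)) := by
  have hM := h.nonneg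
  have hcrime := A.crime_nonneg (k := k)
  have hmu := A.mu_nonneg (k := k)
  set q : D.V (k + 1) := harmPart (A.π (k + 1) u) with hqdef
  have hq : q ∈ D.harmonic k := harmPart_mem _
  rw [norm_cocycle (harmonic_le_cocycles hq)]
  refine le_of_sq_le_mul_self (norm_nonneg _) (by positivity) ?_
  have h1 := A.abs_inner_toW_π_sub_le hM A.crime_one h.norm_i_one h.norm_π_one u
    (D.toW (k + 1) q)
  have h2 := h.abs_inner_toFun_harmonic_le hu hq
  have h3 := inner_harmPart (A.π (k + 1) u) hq
  rw [← hqdef, real_inner_self_eq_norm_sq] at h3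
  rw [h3]
  rw [abs_le] at h1 h2
  linarith

/-- The error in terms of the errors of `i_h π_h`. -/
theorem mixed_error_le (h : A.IsBoundedBy k M)
    {F : C.V (k + 1) → C.W (k + 1)} {Fh : D.V (k + 1) → D.W (k + 1)}
    (hLip : ∀ x y : D.V (k + 1), ‖Fh x - Fh y‖ ≤ M * ‖x - y‖)
    (hmon : ∀ x y : D.V (k + 1),
      0 ≤ inner ℝ (Fh x - Fh y) (D.toW (k + 1) x - D.toW (k + 1) y))
    {f : C.W (k + 1)} {fh : D.W (k + 1)}
    {σ : C.V k} {u p : C.V (k + 1)} {σh : D.V k} {uh ph : D.V (k + 1)}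
    (hs : C.IsMixedSolution k F f σ u p) (hsh : D.IsMixedSolution k Fh fh σh uh ph) {E : ℝ}
    (hE : ‖σ - A.i.onV k (A.π k σ)‖ + ‖u - A.i.onV (k + 1) (A.π (k + 1) u)‖
        + ‖p - A.i.onV (k + 1) (A.π (k + 1) p)‖
        + A.mu k * ‖C.projB k u - A.i.onV (k + 1) (A.π (k + 1) (C.projB k u))‖
        + ‖A.iAdj (k + 1) (f - F (u + p)) - (fh - Fh (A.projVh (k + 1) (u + p)))‖
        + A.crime k * ‖f - F (u + p)‖ ≤ E) :
    ‖σ - A.i.onV k σh‖ + ‖u - A.i.onV (k + 1) uh‖ + ‖p - A.i.onV (k + 1) ph‖ ≤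
      39160 * M ^ 21 * E := by
  have hM := h.nonneg
  have hω := A.crime_nonneg (k := k)
  have hμ := A.mu_nonneg (k := k)
  have hstab := hs.norm_le h.one_le h.poincare_zero h.poincare_one
  set g := f - F (u + p) with hg
  set ω := A.crime k with hωdef
  set Eσ := ‖σ - A.i.onV k (A.π k σ)‖ with hEσ
  set Eu := ‖u - A.i.onV (k + 1) (A.π (k + 1) u)‖ with hEu
  set Ep := ‖p - A.i.onV (k + 1) (A.π (k + 1) p)‖ with hEp
  set EB := A.mu k * ‖C.projB k u - A.i.onV (k + 1) (A.π (k + 1) (C.projB k u))‖ with hEB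
  set δ := ‖A.iAdj (k + 1) g - (fh - Fh (A.projVh (k + 1) (u + p)))‖ with hδ
  have nσ : 0 ≤ Eσ := norm_nonneg _
  have nu : 0 ≤ Eu := norm_nonneg _
  have np : 0 ≤ Ep := norm_nonneg _
  have nB : 0 ≤ EB := by positivity
  have nδ : 0 ≤ δ := norm_nonneg _
  have ng : 0 ≤ ω * ‖g‖ := by positivity
  have nE : 0 ≤ E := by linarith
  -- all consistency errors are multiples of `X`
  set Y := 44 * M ^ 4 * E with hY
  set X := M ^ 3 * Y with hX
  have hEY : E ≤ Y := le_mul_of_one_le_left nE (by nlinarith [one_le_pow₀ h.one_le (n := 4)])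
  have nY : 0 ≤ Y := nE.trans hEY
  have hMX : M * Y ≤ X := mul_le_mul_of_nonneg_right (le_self_pow₀ h.one_le (by norm_num)) nY
  have hYM : Y ≤ M * Y := le_mul_of_one_le_left nY h.one_le
  have nX : 0 ≤ X := by linarith
  have hXM : X ≤ M * X := le_mul_of_one_le_left nX h.one_le
  -- The a priori bound trades the norms of the solution for `‖g‖`.
  have hωY : ω * (‖σ‖ + ‖u‖ + ‖p‖) ≤ Y := by
    have h1 := mul_le_mul_of_nonneg_left hstab hω
    have h2 : ω * ‖g‖ ≤ E := by linarith
    have h3 := mul_le_mul_of_nonneg_left h2 (show 0 ≤ 44 * M ^ 4 by positivity)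
    linarith
  have n1 : 0 ≤ ω * ‖σ‖ := by positivity
  have n2 : 0 ≤ ω * ‖u‖ := by positivity
  have n3 : 0 ≤ ω * ‖p‖ := by positivity
  have mσ : M * (ω * ‖σ‖ + Eσ) ≤ 2 * X := by
    have := mul_le_mul_of_nonneg_left (show ω * ‖σ‖ + Eσ ≤ 2 * Y by linarith) hM
    linarith
  have mu' : M * (ω * ‖u‖ + Eu) ≤ 2 * X := by
    have := mul_le_mul_of_nonneg_left (show ω * ‖u‖ + Eu ≤ 2 * Y by linarith) hM
    linarith
  have mp : M * (ω * ‖p‖ + Ep) ≤ 2 * X := by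
    have := mul_le_mul_of_nonneg_left (show ω * ‖p‖ + Ep ≤ 2 * Y by linarith) hM
    linarith
  set b := D.projB k (A.π (k + 1) p) with hb
  have hbX : ‖b‖ ≤ 2 * X := (h.norm_projB_π_le hs.harmonic_mem).trans mp
  set q : D.V (k + 1) := harmPart (A.π (k + 1) u) with hq
  have hqH : q ∈ D.harmonic k := harmPart_mem _
  have hqX : ‖q‖ ≤ 7 * X := by
    have h1 := h.norm_harmPart_π_le hs.eq_trd
    have h2 := mul_le_mul_of_nonneg_left (show EB ≤ Y by linarith) hM
    have h3 := mul_le_mul_of_nonneg_left (show ω * ‖u‖ ≤ Y by linarith)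
      (show 0 ≤ M ^ 3 by positivity)
    linarith
  -- the discrete errors
  set s := σh - A.π k σ with hsdef
  -- Removing `q` makes `e` orthogonal to the discrete harmonic space; removing `b` makes `r`
  -- harmonic.
  set e := uh - (A.π (k + 1) u - q) with hedef
  set r := ph - (A.π (k + 1) p - b) with hrdef
  have hpZ : A.π (k + 1) p ∈ D.cocycles (k + 1) :=
    A.π_mem_cocycles (harmonic_le_cocycles hs.harmonic_mem)
  have hrH : r ∈ D.harmonic k :=
    Submodule.sub_mem _ hsh.harmonic_mem (sub_projB_mem_harmonic hpZ)
  set y := A.π (k + 1) u - q + (A.π (k + 1) p - b) with hy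
  have her : e + r = uh + ph - y := by
    rw [hedef, hrdef, hy]
    abel
  have hPy : ‖A.projVh (k + 1) (u + p) - y‖ ≤ 11 * X := by
    have h1 := norm_projVh_sub_π_le (A := A) hM h.norm_π_one (u + p)
    have h2 : u + p - A.i.onV (k + 1) (A.π (k + 1) (u + p)) =
        (u - A.i.onV (k + 1) (A.π (k + 1) u)) + (p - A.i.onV (k + 1) (A.π (k + 1) p)) := by
      simp only [map_add]
      abel
    have h3 := norm_add_le (u - A.i.onV (k + 1) (A.π (k + 1) u))
      (p - A.i.onV (k + 1) (A.π (k + 1) p))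
    rw [← h2, ← hEu, ← hEp] at h3
    have h4 : A.projVh (k + 1) (u + p) - y =
        A.projVh (k + 1) (u + p) - A.π (k + 1) (u + p) + (q + b) := by
      rw [hy, map_add (A.π (k + 1))]
      abel
    have h5 := norm_add_le (A.projVh (k + 1) (u + p) - A.π (k + 1) (u + p)) (q + b)
    have h6 := norm_add_le q b
    have h7 := mul_le_mul_of_nonneg_left (h3.trans (show Eu + Ep ≤ Y by linarith)) hM
    rw [h4]
    linarith
  have hM3 : M ≤ M ^ 3 := le_self_pow₀ h.one_le (by norm_num)
  -- `Fh` is compared at `y`, not at the projection of `u + p`, so that monotonicity acts on exactly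
  -- `e + r`. The factor 20 sums `X` for the data, `11 M X` for moving `Fh` to `y`, `2 X` for `b`
  -- and `6 X` for three consistency errors.
  have hst : ‖s‖ + ‖e‖ + ‖r‖ ≤ 44 * (M ^ 3) ^ 4 * (20 * (M * X)) := by
    refine mixed_stability (φ := Fh (uh + ph) - Fh y) (one_le_pow₀ h.one_le) (by positivity)
      h.discrete_poincare_zero h.discrete_poincare_one hrH (fun q' hq' => ?_) ?_ ?_
      (fun τ => ?_) (fun v => ?_)
    · have h1 := inner_harmPart (A.π (k + 1) u) hq'
      have h2 := hsh.eq_trd q' hq'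
      rw [← hq] at h1
      rw [hedef, map_sub, map_sub, inner_sub_left, inner_sub_left, h1, h2]
      ring
    · rw [her, map_sub]
      exact hmon _ _
    · rw [her]
      exact (hLip _ _).trans (mul_le_mul_of_nonneg_right hM3 (norm_nonneg _))
    · have h1 := hsh.eq_fst τ
      have h2 := hs.eq_fst (A.i.onV k τ)
      have h3 := A.abs_inner_toW_π_sub_le hM A.crime_zero h.norm_i_zero h.norm_π_zero σ
        (D.toW k τ)
      have h4 := A.abs_inner_toW_π_sub_le hM A.crime_one h.norm_i_one h.norm_π_one u
        (D.dW k τ)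
      have h5 := inner_dW_harmonic τ hqH
      rw [real_inner_comm] at h5
      rw [dW_onV, toW_onV] at h2
      have h6 : inner ℝ (D.toW k s) (D.toW k τ) - inner ℝ (D.toW (k + 1) e) (D.dW k τ) =
          -(inner ℝ (D.toW k (A.π k σ)) (D.toW k τ)
            - inner ℝ (C.toW k σ) (A.i.toFun k (D.toW k τ)))
          + (inner ℝ (D.toW (k + 1) (A.π (k + 1) u)) (D.dW k τ)
            - inner ℝ (C.toW (k + 1) u) (A.i.toFun (k + 1) (D.dW k τ))) := by
        rw [hsdef, hedef]
        simp only [map_sub, inner_sub_left]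
        linarith
      have h7 := mul_le_mul mσ (D.norm_toW_le τ) (norm_nonneg _) (by positivity)
      have h8 := mul_le_mul mu' (D.norm_dW_le τ) (norm_nonneg _) (by positivity)
      have h9 := mul_le_mul_of_nonneg_right hXM (norm_nonneg τ)
      have h10 : 0 ≤ X * ‖τ‖ := by positivity
      rw [h6]
      refine (abs_add_le _ _).trans ?_
      rw [abs_neg]
      linarith
    · have h1 := hsh.eq_snd v
      have h2 := hs.eq_snd (A.i.onV (k + 1) v)
      have h3 := A.abs_inner_dW_π_sub_le hM A.crime_one h.norm_i_one h.norm_π_zero σ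
        (D.toW (k + 1) v)
      have h4 := A.abs_inner_dW_π_sub_le hM A.crime_two h.norm_i_two h.norm_π_one u
        (D.dW (k + 1) v)
      have h5 := A.abs_inner_toW_π_sub_le hM A.crime_one h.norm_i_one h.norm_π_one p
        (D.toW (k + 1) v)
      rw [dW_onV, toW_onV] at h2
      have h6 : inner ℝ (A.iAdj (k + 1) g) (D.toW (k + 1) v) =
          inner ℝ f (A.i.toFun (k + 1) (D.toW (k + 1) v)) -
          inner ℝ (F (u + p)) (A.i.toFun (k + 1) (D.toW (k + 1) v)) := by
        rw [iAdj, ContinuousLinearMap.adjoint_inner_left, hg, inner_sub_left]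
      have h7 : D.dW (k + 1) q = 0 := mem_cocycles_iff.1 (harmonic_le_cocycles hqH)
      have h8 : inner ℝ (D.dW k s) (D.toW (k + 1) v) + inner ℝ (D.dW (k + 1) e) (D.dW (k + 1) v)
          + inner ℝ (D.toW (k + 1) r) (D.toW (k + 1) v)
          + inner ℝ (Fh (uh + ph) - Fh y) (D.toW (k + 1) v) =
          -(inner ℝ (A.iAdj (k + 1) g - (fh - Fh (A.projVh (k + 1) (u + p)))) (D.toW (k + 1) v))
          + inner ℝ (Fh (A.projVh (k + 1) (u + p)) - Fh y) (D.toW (k + 1) v)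
          + inner ℝ (D.toW (k + 1) b) (D.toW (k + 1) v)
          - (inner ℝ (D.dW k (A.π k σ)) (D.toW (k + 1) v)
            - inner ℝ (C.dW k σ) (A.i.toFun (k + 1) (D.toW (k + 1) v)))
          - (inner ℝ (D.dW (k + 1) (A.π (k + 1) u)) (D.dW (k + 1) v)
            - inner ℝ (C.dW (k + 1) u) (A.i.toFun (k + 1 + 1) (D.dW (k + 1) v)))
          - (inner ℝ (D.toW (k + 1) (A.π (k + 1) p)) (D.toW (k + 1) v)
            - inner ℝ (C.toW (k + 1) p) (A.i.toFun (k + 1) (D.toW (k + 1) v))) := by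
        rw [hsdef, hedef, hrdef]
        simp only [map_sub, inner_sub_left, h7, sub_zero, h6]
        linarith
      have nv := D.norm_toW_le v
      have h9 := mul_le_mul mσ nv (norm_nonneg _) (by positivity)
      have h10 := mul_le_mul mu' (D.norm_dW_le v) (norm_nonneg _) (by positivity)
      have h11 := mul_le_mul mp nv (norm_nonneg _) (by positivity)
      have h12 := abs_real_inner_le_norm
        (A.iAdj (k + 1) g - (fh - Fh (A.projVh (k + 1) (u + p)))) (D.toW (k + 1) v)
      have h13 := mul_le_mul (show δ ≤ X by linarith) nv (norm_nonneg _) nX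
      have h14 := abs_real_inner_le_norm (Fh (A.projVh (k + 1) (u + p)) - Fh y) (D.toW (k + 1) v)
      have h15 := mul_le_mul ((hLip (A.projVh (k + 1) (u + p)) y).trans
        (mul_le_mul_of_nonneg_left hPy hM)) nv (norm_nonneg _) (by positivity)
      have h16 := abs_real_inner_le_norm (D.toW (k + 1) b) (D.toW (k + 1) v)
      have h17 := mul_le_mul ((D.norm_toW_le b).trans hbX) nv (norm_nonneg _) (by positivity)
      have h18 := mul_le_mul_of_nonneg_right hXM (norm_nonneg v)
      rw [h8]
      rw [abs_le] at h3 h4 h5 h12 h14 h16 ⊢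
      constructor <;> linarith
  have fσ : ‖σ - A.i.onV k σh‖ ≤ Eσ + M * ‖s‖ := by
    have h1 : σ - A.i.onV k σh = (σ - A.i.onV k (A.π k σ)) - A.i.onV k s := by
      rw [hsdef, map_sub]
      abel
    rw [h1]
    exact (norm_sub_le _ _).trans (add_le_add le_rfl (h.norm_onV_zero s))
  have fu : ‖u - A.i.onV (k + 1) uh‖ ≤ Eu + M * (‖q‖ + ‖e‖) := by
    have h1 : u - A.i.onV (k + 1) uh =
        (u - A.i.onV (k + 1) (A.π (k + 1) u)) + A.i.onV (k + 1) (q - e) := by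
      rw [hedef]
      simp only [map_sub]
      abel
    rw [h1]
    exact (norm_add_le _ _).trans (add_le_add le_rfl ((h.norm_onV_one _).trans
      (mul_le_mul_of_nonneg_left (norm_sub_le _ _) hM)))
  have fp : ‖p - A.i.onV (k + 1) ph‖ ≤ Ep + M * (‖b‖ + ‖r‖) := by
    have h1 : p - A.i.onV (k + 1) ph =
        (p - A.i.onV (k + 1) (A.π (k + 1) p)) + A.i.onV (k + 1) (b - r) := by
      rw [hrdef]
      simp only [map_sub]
      abel
    rw [h1]
    exact (norm_add_le _ _).trans (add_le_add le_rfl ((h.norm_onV_one _).trans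
      (mul_le_mul_of_nonneg_left (norm_sub_le _ _) hM)))
  have t1 := mul_le_mul_of_nonneg_left hst hM
  have t2 := mul_le_mul_of_nonneg_left (add_le_add hqX hbX) hM
  have t3 : M * X ≤ M ^ 14 * X :=
    mul_le_mul_of_nonneg_right (le_self_pow₀ h.one_le (by norm_num)) nX
  -- 880 = 44 · 20 from stability, 9 from the corrections `q` and `b`, 1 from the projection errors;
  -- then `X = 44 M ^ 7 E`.
  have t4 : 39160 * M ^ 21 * E = 890 * (M ^ 14 * X) := by
    rw [hX, hY]
    ring
  rw [t4]
  linarith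

end IsBoundedBy

end Discretization

end HilbertComplex

/-! ### The theorem, with the mixed problem in degree `k + 1`. -/

theorem mainTheorem5 (cP Mi Mπ Λ : ℝ) :
    ∃ c : ℝ, 0 < c ∧
      ∀ (C : HilbertComplex.{u}) (D : HilbertComplex.{v}) (A : C.Discretization D) (k : ℤ),
        C.IsClosedComplex →
        C.poincareConst k ≤ cP → C.poincareConst (k + 1) ≤ cP →
        (∀ j ∈ Set.Icc k (k + 2), ‖A.i.toFun j‖ ≤ Mi) →
        (∀ j ∈ Set.Icc k (k + 2), ‖A.π j‖ ≤ Mπ) →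
      ∀ (F : C.V (k + 1) → C.W (k + 1)) (Fh : D.V (k + 1) → D.W (k + 1)),
        (∀ x y : D.V (k + 1), ‖Fh x - Fh y‖ ≤ Λ * ‖x - y‖) →
        (∀ x y : D.V (k + 1),
          0 ≤ inner ℝ (Fh x - Fh y) (D.toW (k + 1) x - D.toW (k + 1) y)) →
      ∀ (f : C.W (k + 1)) (fh : D.W (k + 1))
        (σ : C.V k) (u p : C.V (k + 1)) (σh : D.V k) (uh ph : D.V (k + 1)),
        C.IsMixedSolution k F f σ u p →
        D.IsMixedSolution k Fh fh σh uh ph →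
        ‖σ - A.i.onV k σh‖ + ‖u - A.i.onV (k + 1) uh‖
            + ‖C.toW (k + 1) (p - A.i.onV (k + 1) ph)‖
          ≤ c * ((⨅ τ : D.V k, ‖σ - A.i.onV k τ‖)
              + (⨅ v : D.V (k + 1), ‖u - A.i.onV (k + 1) v‖)
              + (⨅ q : D.V (k + 1), ‖p - A.i.onV (k + 1) q‖)
              + A.mu k * (⨅ v : D.V (k + 1), ‖C.projB k u - A.i.onV (k + 1) v‖)
              + ‖A.iAdj (k + 1) (f - F (u + p)) - (fh - Fh (A.projVh (k + 1) (u + p)))‖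
              + A.crime k * ‖f - F (u + p)‖) := by
  set M : ℝ := 1 + |cP| + |Mi| + |Mπ| + |Λ| with hMdef
  have a1 := abs_nonneg cP
  have a2 := abs_nonneg Mi
  have a3 := abs_nonneg Mπ
  have a4 := abs_nonneg Λ
  have b1 : cP ≤ M := by linarith [le_abs_self cP]
  have b2 : Mi ≤ M := by linarith [le_abs_self Mi]
  have b3 : Mπ ≤ M := by linarith [le_abs_self Mπ]
  have b4 : Λ ≤ M := by linarith [le_abs_self Λ]
  have hM : 1 ≤ M := by linarith
  have hM0 : 0 < M := by linarith
  -- The factor `2 * M ^ 2` is the quasi-optimality constant that replaces errors of `i π` by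
  -- infima.
  refine ⟨39160 * M ^ 21 * (2 * M ^ 2), by positivity, ?_⟩
  intro C D A k hC hP0 hP1 hi hπ F Fh hLip hmon f fh σ u p σh uh ph hs hsh
  have h : A.IsBoundedBy k M :=
    { one_le := hM
      closed := hC
      norm_i_zero := (hi k ⟨le_rfl, by omega⟩).trans b2
      norm_i_one := (hi (k + 1) ⟨by omega, by omega⟩).trans b2
      norm_i_two := (hi (k + 1 + 1) ⟨by omega, by omega⟩).trans b2
      norm_π_zero := (hπ k ⟨le_rfl, by omega⟩).trans b3
      norm_π_one := (hπ (k + 1) ⟨by omega, by omega⟩).trans b3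
      poincare_zero := (hC.poincareBound k).mono (hP0.trans b1)
      poincare_one := (hC.poincareBound (k + 1)).mono (hP1.trans b1) }
  have hLip' : ∀ x y : D.V (k + 1), ‖Fh x - Fh y‖ ≤ M * ‖x - y‖ := fun x y =>
    (hLip x y).trans (mul_le_mul_of_nonneg_right b4 (norm_nonneg _))
  have hp := C.norm_toW_le (p - A.i.onV (k + 1) ph)
  have hw : ∀ x : ℝ, 0 ≤ x → x ≤ 2 * M ^ 2 * x := fun x hx =>
    le_mul_of_one_le_left hx (by linarith [one_le_pow₀ hM (n := 2)])
  have hmain := h.mixed_error_le hLip' hmon hs hsh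
    (add_le_add (add_le_add (add_le_add (add_le_add (add_le_add (h.quasiopt_zero σ)
      (h.quasiopt_one u)) (h.quasiopt_one p))
      (mul_le_mul_of_nonneg_left (h.quasiopt_one (C.projB k u)) A.mu_nonneg))
      (hw _ (norm_nonneg _)))
      (hw _ (mul_nonneg A.crime_nonneg (norm_nonneg _))))
  refine ((add_le_add le_rfl hp).trans hmain).trans (le_of_eq ?_)
  have key : ∀ K L a b c m d e w : ℝ, K * (L * a + L * b + L * c + m * (L * d) + L * e + L * w) =
      K * L * (a + b + c + m * d + e + w) := fun K L a b c m d e w => by ring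
  exact key _ _ _ _ _ _ _ _ _
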